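/- Let $X=(X_t)_{t\ge 0}$ be a real Lévy process on a probability space $(\Omega,\mathcal F,P)$, i.e. $X_0=0$ a.s., $X$ has independent stationary increments and a.s. càdlàg paths. Let $N>0$ and $0<D\le x$. Write $S_t=x\exp(X_t)$, and write $P_x$ for $P$ when the starting value $x$ of $S$ has to be shown. Let $$\tau_r=\inf\{kN:\ k\ge 1,\ S_{kN}\le D\},\qquad \tau_e=\sup\{t\in[\tau_r-N,\tau_r]:\ S_t\ge D\},$$ with $\tau_e=\infty$ if $\tau_r=\infty$. Then $\tau_r$ and $\tau_e$ are random variables (measurable up to null sets), and on $[0,\infty)$ $$\begin{aligned}P_x[\tau_e\in du]&=\sum_{k\ge1}P_x[\tau_e\in du\mid\tau_r=kN]\,P_x[\tau_r=kN]\\ &=\sum_{k\ge1}P_x[\tau_r-\tau_e\in d(kN-u)\mid\tau_r=kN]\,P_x[\tau_r=kN]\\ &=\sum_{k\ge1}P_x[\tau_r-\tau_e\in d(kN-u)\mid\tau_r=kN]\int_0^\infty P_x[\tau_r=kN,\ S_{\tau_r}\in dy],\end{aligned}$$ where $P_x[\tau_r-\tau_e\in d(kN-u)\mid \tau_r=kN]$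 denotes the image of the law $P_x[\tau_r-\tau_e\in ds\mid\tau_r=kN]$ under $s\mapsto kN-s$, and a law conditioned on a null event is read as $0$. The factors are given as follows. (a) For every $k\ge1$, $$P_x[\tau_r-\tau_e\in ds\mid\tau_r=kN]=\int_{[D,\infty)}P_u[\tau_r-\tau_e\in ds\mid\tau_r=N]\;P_x[S_{(k-1)N}\in du\mid\tau_r=kN].$$ (b) If $X$ is spectrally positive (a.s. it has no negative jumps), then for every $u\ge D$, with $H_D=\inf\{t:S_t\le D\}$, $$P_u[\tau_r-\tau_e\in ds\mid\tau_r=N]=\int_{[0,N]}P[\mathcal A_v\in ds]\;P_u[H_D\in dv\mid\tau_r=N],$$ where $\mathcal A_v$ has the law of $\inf\{t\le N-v:\ X_{N-v-t}\ge 0\}$ conditioned on $X_{N-v}\le0$. (c) Suppose $D<x$. Let $F$ be the law of $X_N$. For the random walk $(X_{mN})_{m\ge0}$ let $T^+_0=T^-_0=0$, $T_{n+1}^+=\min\{m>T_n^+:X_{mN}>X_{T_n^+N}\}$, $T_{n+1}^-=\min\{m>T_n^-:X_{mN}\le X_{T_n^-N}\}$ (infinite if there is no such $m$), $H_n^{+}=X_{T_n^{+}N}$,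 $H_n^-=-X_{T_n^-N}$, and $U^\pm(dh,i)=\sum_{n\ge0}P[H_n^\pm\in dh,\ T_n^\pm=i]$. Then for every $k\ge1$ the joint law of $\tau_r$ and $\log S_{\tau_r}$ is concentrated on $y\le\log D$, where $$P_x[\tau_r=kN,\ \log S_{\tau_r}\in dy]=\sum_{i=0}^{k-1}\int_{(\log D,\log x]}U^-(\log x-dz,\,i)\int_{[z,\infty)}U^+(du-z,\,k-1-i)\,F(dy-u).$$ -/

import Mathlib

open MeasureTheory ProbabilityTheory Set Filter Topology
open scoped NNReal ENNReal

namespace EconomicDefault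

noncomputable section

/-- A real-valued Lévy process: it starts at `0`, has independent and stationary increments, and
almost all of its paths are right-continuous with left limits. -/
structure IsLevyProcess {Ω : Type*} [MeasurableSpace Ω] (X : ℝ≥0 → Ω → ℝ) (P : Measure Ω) :
    Prop where
  measurable : ∀ t, Measurable (X t)
  start : ∀ᵐ ω ∂P, X 0 ω = 0
  indepIncrements : HasIndepIncrements X P
  stationaryIncrements : ∀ s t, IdentDistrib (fun ω => X (s + t) ω - X s ω) (X t) P P
  cadlag : ∀ᵐ ω ∂P, ∀ t, ContinuousWithinAt (fun s => X s ω) (Ioi t) t ∧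
    ∃ l, Tendsto (fun s => X s ω) (𝓝[<] t) (𝓝 l)

/-- Spectral positivity: almost surely the path never jumps downwards. -/
def IsSpectrallyPositive {Ω : Type*} [MeasurableSpace Ω] (X : ℝ≥0 → Ω → ℝ) (P : Measure Ω) :
    Prop :=
  ∀ᵐ ω ∂P, ∀ t, 0 < t → ∀ l, Tendsto (fun s => X s ω) (𝓝[<] t) (𝓝 l) → l ≤ X t ω

section Model

variable {Ω : Type*}

/-- The firm value `S_t = x exp(X_t)` started from `S_0 = x`. Under `P`, this process has the law
that is denoted `P_x`. -/
def firmValue (X : ℝ≥0 → Ω → ℝ) (x : ℝ) (t : ℝ≥0) (ω : Ω) : ℝ :=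
  x * Real.exp (X t ω)

/-- The recorded default time `τ_r = inf {kN : k ≥ 1, S_{kN} ≤ D}`, infinite if there is no such
`k`. -/
def recordedDefault (X : ℝ≥0 → Ω → ℝ) (N : ℝ≥0) (D x : ℝ) (ω : Ω) : ℝ≥0∞ :=
  sInf {t | ∃ k : ℕ, 1 ≤ k ∧ t = ((k * N : ℝ≥0) : ℝ≥0∞) ∧ firmValue X x (k * N) ω ≤ D}

/-- The event `{τ_r = kN}`. -/
def defaultAt (X : ℝ≥0 → Ω → ℝ) (N : ℝ≥0) (D x : ℝ) (k : ℕ) : Set Ω :=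
  {ω | recordedDefault X N D x ω = ((k * N : ℝ≥0) : ℝ≥0∞)}

open Classical in
/-- The economic default time `τ_e = sup {t ∈ [τ_r - N, τ_r] : S_t ≥ D}`, infinite if there is no
recorded default. -/
def economicDefault (X : ℝ≥0 → Ω → ℝ) (N : ℝ≥0) (D x : ℝ) (ω : Ω) : ℝ≥0∞ :=
  if recordedDefault X N D x ω = ∞ then ∞ else
    sSup {t | ∃ s : ℝ≥0, t = (s : ℝ≥0∞) ∧ recordedDefault X N D x ω - N ≤ s ∧
      s ≤ recordedDefault X N D x ω ∧ D ≤ firmValue X x s ω}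

/-- The firm value `S_{τ_r}` at recorded default (of interest on `{τ_r < ∞}` only). -/
def defaultValue (X : ℝ≥0 → Ω → ℝ) (N : ℝ≥0) (D x : ℝ) (ω : Ω) : ℝ :=
  firmValue X x (recordedDefault X N D x ω).toNNReal ω

/-- The first passage time `H_D = inf {t : S_t ≤ D}` in continuous time. -/
def firstPassage (X : ℝ≥0 → Ω → ℝ) (D x : ℝ) (ω : Ω) : ℝ≥0∞ :=
  sInf {t | ∃ s : ℝ≥0, t = (s : ℝ≥0∞) ∧ firmValue X x s ω ≤ D}

/-- The time elapsed at `r` since the path was last nonnegative: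
`inf {s ≤ r : X_{r-s} ≥ 0}`. -/
def negativeAge (X : ℝ≥0 → Ω → ℝ) (r : ℝ≥0) (ω : Ω) : ℝ≥0∞ :=
  sInf {t | ∃ s : ℝ≥0, t = (s : ℝ≥0∞) ∧ s ≤ r ∧ 0 ≤ X (r - s) ω}

end Model

section Laws

variable {Ω : Type*} [MeasurableSpace Ω]

/-- The conditional law `P_x[τ_r - τ_e ∈ ds | τ_r = kN]`. -/
def delayLaw (X : ℝ≥0 → Ω → ℝ) (P : Measure Ω) (N : ℝ≥0) (D x : ℝ) (k : ℕ) : Measure ℝ≥0∞ :=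
  (P[|defaultAt X N D x k]).map
    (fun ω => recordedDefault X N D x ω - economicDefault X N D x ω)

/-- The joint law `P_x[τ_r = kN, S_{τ_r} ∈ dy]`. -/
def jointLaw (X : ℝ≥0 → Ω → ℝ) (P : Measure Ω) (N : ℝ≥0) (D x : ℝ) (k : ℕ) : Measure ℝ :=
  (P.restrict (defaultAt X N D x k)).map (defaultValue X N D x)

/-- The law of `inf {s ≤ r : X_{r-s} ≥ 0}` given that `X_r ≤ 0`. -/
def negativeAgeLaw (X : ℝ≥0 → Ω → ℝ) (P : Measure Ω) (r : ℝ≥0) : Measure ℝ≥0∞ :=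
  (P[|{ω | X r ω ≤ 0}]).map (negativeAge X r)

end Laws

section Ladder

/-- Strict ascending ladder times of a sequence: `T_0 = 0` and
`T_{n+1} = min {m > T_n : w_m > w_{T_n}}`, infinite if there is no such `m`. -/
def ascendingLadderTime (w : ℕ → ℝ) : ℕ → ℕ∞
  | 0 => 0
  | n + 1 => sInf {r | ∃ m : ℕ, r = (m : ℕ∞) ∧ ascendingLadderTime w n < m ∧
      w (ascendingLadderTime w n).toNat < w m}

/-- Weak descending ladder times of a sequence: `T_0 = 0` and
`T_{n+1} = min {m > T_n : w_m ≤ w_{T_n}}`, infinite if there is no such `m`. -/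
def descendingLadderTime (w : ℕ → ℝ) : ℕ → ℕ∞
  | 0 => 0
  | n + 1 => sInf {r | ∃ m : ℕ, r = (m : ℕ∞) ∧ descendingLadderTime w n < m ∧
      w m ≤ w (descendingLadderTime w n).toNat}

variable {Ω : Type*} [MeasurableSpace Ω]

/-- The Green function `U⁺(dh, i) = ∑_n P[H_n ∈ dh, T_n = i]` of the strict ascending ladder
process of the random walk `(X_{mN})_m`, where `H_n` is the value of the walk at `T_n`. -/
def ascendingGreen (X : ℝ≥0 → Ω → ℝ) (P : Measure Ω) (N : ℝ≥0) (i : ℕ) : Measure ℝ :=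
  Measure.sum fun n : ℕ =>
    (P.restrict {ω | ascendingLadderTime (fun m : ℕ => X (m * N) ω) n = (i : ℕ∞)}).map
      (fun ω => X (((ascendingLadderTime (fun m : ℕ => X (m * N) ω) n).toNat : ℝ≥0) * N) ω)

/-- The Green function `U⁻(dh, i) = ∑_n P[H_n ∈ dh, T_n = i]` of the weak descending ladder
process of the random walk `(X_{mN})_m`, where `H_n ≥ 0` is the depth of the walk (minus its
value) at `T_n`. -/
def descendingGreen (X : ℝ≥0 → Ω → ℝ) (P : Measure Ω) (N : ℝ≥0) (i : ℕ) : Measure ℝ :=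
  Measure.sum fun n : ℕ =>
    (P.restrict {ω | descendingLadderTime (fun m : ℕ => X (m * N) ω) n = (i : ℕ∞)}).map
      (fun ω => -X (((descendingLadderTime (fun m : ℕ => X (m * N) ω) n).toNat : ℝ≥0) * N) ω)

end Ladder

end

end EconomicDefault

/-! Default at the `(k+1)`-st inspection means that the firm survived the first `k` inspections and
that the next increment of `X` brings it to `D` or below. By the Markov property the path after the
inspection at `kN` is a fresh copy of `X`, independent of the past. Given the value `u` at that
inspection, both the default and the delay depend on the fresh path alone: the delay is the time
since that path was last at or above `log (D / u)` (`delayAge`). Disintegrating a restricted product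
law along `u` (`restrict_apply_eq_lintegral_cond`) gives the mixture over the last value before
default.

In the spectrally positive case the same disintegration is applied along the first passage time `H`.
Without downward jumps the path is exactly at the level at time `H` (`eq_level_at_first_passage`),
and by the strong Markov property (`IsLevyProcess.map_shiftedPath_pathHit`) the path after `H` is a
fresh copy independent of `H`. Given `H = v`, default at `N` says that this copy is at most `0` at
time `N - v`, and the delay is its age since it was last nonnegative.

For the joint law the walk is split at the last minimum before default. Up to that index it makes a
weak descending record, afterwards it stays strictly above the minimum, and then one free step takes
it to `log D` or below; survival amounts to the minimum lying above `log D`. The Markov property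
factors these pieces, and reversal of the increments turns "stays positive" into "is at a strict
ascending record" (`IsLevyProcess.ascendingGreen_eq`). Each index carries at most one ladder number,
so the Green functions are laws on record events.

The ages and passage times are infima over uncountably many times. Paths are therefore encoded by
their values on a countable grid, from which right-continuity recovers them. The sublevel sets of
such infima are projections of measurable sets, hence analytic and null measurable
(`nullMeasurableSet_image_fst`); the later arguments accept null measurable events for this reason.
-/

namespace EconomicDefault

noncomputable section

/-! ### Analytic sets and measurable projection. -/

section Capacitability

theorem isCompact_setOf_forall_le (b : ℕ → ℕ) : IsCompact {y : ℕ → ℕ | ∀ j, y j ≤ b j} := by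
  have : {y : ℕ → ℕ | ∀ j, y j ≤ b j} = Set.univ.pi fun j => Set.Iic (b j) := by
    ext y
    simp only [Set.mem_pi, Set.mem_univ, Set.mem_Iic, true_imp_iff]
    rfl
  rw [this]
  exact isCompact_univ_pi fun j => (Set.finite_Iic (b j)).isCompact

/-- If `K = {x | x ≤ b}` in Baire space lies in an open set, so does a neighbourhood of it that
constrains only finitely many coordinates. -/
theorem exists_forall_lt_le_subset_of_isOpen (b : ℕ → ℕ) {V : Set (ℕ → ℕ)} (hV : IsOpen V)
    (hb : {x | ∀ j, x j ≤ b j} ⊆ V) : ∃ i, {x : ℕ → ℕ | ∀ j < i, x j ≤ b j} ⊆ V := by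
  by_contra! hcon
  simp only [Set.not_subset] at hcon
  choose x hx hxV using hcon
  have hK : IsCompact {y : ℕ → ℕ | ∀ j, y j ≤ b j} := isCompact_setOf_forall_le b
  -- Truncation moves the points into the compact box. It leaves the first `i` coordinates of `x i`
  -- unchanged, so the original subsequence has the same coordinatewise limit.
  let z : ℕ → ℕ → ℕ := fun i j => min (x i j) (b j)
  obtain ⟨y, hy, φ, hφ, hlim⟩ := hK.tendsto_subseq (x := z) (fun i j => min_le_right _ _)
  have hlim' : Tendsto (x ∘ φ) atTop (𝓝 y) := by
    rw [tendsto_pi_nhds] at hlim ⊢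
    intro j
    refine (hlim j).congr' ?_
    filter_upwards [eventually_gt_atTop j] with n hn
    exact min_eq_left (hx (φ n) j (hn.trans_le (hφ.id_le n)))
  have hmem : y ∈ Vᶜ := hV.isClosed_compl.mem_of_tendsto hlim'
    (Eventually.of_forall fun n => hxV (φ n))
  exact hmem (hb hy)

/-- Inner regularity of a finite measure on the continuous image of Baire space. -/
theorem exists_isCompact_le_measure_of_lt_measure_range {α : Type*} [TopologicalSpace α]
    [T2Space α] [MeasurableSpace α] (μ : Measure α) [μ.OuterRegular]
    {f : (ℕ → ℕ) → α} (hf : Continuous f) {c : ℝ≥0∞} (hc : c < μ (range f)) :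
    ∃ K, IsCompact K ∧ K ⊆ range f ∧ c ≤ μ K := by
  -- Bounding one more coordinate by `m` gives images that increase with `m` to the old one;
  -- continuity from below supplies a bound that keeps the measure above `c`.
  have step : ∀ (i : ℕ) (b : ℕ → ℕ), c < μ (f '' {x | ∀ j < i, x j ≤ b j}) →
      ∃ m, c < μ (f '' {x | ∀ j < i + 1, x j ≤ Function.update b i m j}) := by
    intro i b h
    have hU : f '' {x | ∀ j < i, x j ≤ b j} =
        ⋃ m, f '' {x | ∀ j < i + 1, x j ≤ Function.update b i m j} := by
      rw [← Set.image_iUnion]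
      congr 1
      ext x
      simp only [Set.mem_ofPred_eq, Set.mem_iUnion]
      constructor
      · intro hx
        refine ⟨x i, fun j hj => ?_⟩
        rcases eq_or_ne j i with rfl | hne
        · simp
        · rw [Function.update_of_ne hne]
          exact hx j (by omega)
      · rintro ⟨m, hm⟩ j hj
        have := hm j (by omega)
        rwa [Function.update_of_ne (by omega)] at this
    have hmono : Monotone fun m => f '' {x | ∀ j < i + 1, x j ≤ Function.update b i m j} := by
      intro m m' hmm
      refine Set.image_mono fun x hx j hj => (hx j hj).trans ?_
      rcases eq_or_ne j i with rfl | hne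
      · simpa using hmm
      · simp [Function.update_of_ne hne]
    rw [hU, hmono.measure_iUnion] at h
    exact lt_iSup_iff.1 h
  choose! next hnext using step
  let B : ℕ → ℕ → ℕ := fun i => Nat.rec (fun _ => 0) (fun i b => Function.update b i (next i b)) i
  have hB : ∀ i, c < μ (f '' {x | ∀ j < i, x j ≤ B i j}) := by
    intro i
    induction i with
    | zero => simpa [Set.image_univ] using hc
    | succ i ih => exact hnext i (B i) ih
  let b : ℕ → ℕ := fun j => B (j + 1) j
  have hBb : ∀ i j, j < i → B i j = b j := by
    intro i
    induction i with
    | zero => intro j hj; omega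
    | succ i ih =>
      intro j hj
      rcases eq_or_ne j i with rfl | hne
      · rfl
      · have : B (i + 1) j = B i j := Function.update_of_ne hne _ _
        rw [this, ih j (by omega)]
  have hb : ∀ i, c < μ (f '' {x | ∀ j < i, x j ≤ b j}) := by
    intro i
    have : {x : ℕ → ℕ | ∀ j < i, x j ≤ b j} = {x | ∀ j < i, x j ≤ B i j} := by
      ext x
      exact forall₂_congr fun j hj => by rw [hBb i j hj]
    rw [this]
    exact hB i
  have hK : IsCompact {y : ℕ → ℕ | ∀ j, y j ≤ b j} := isCompact_setOf_forall_le b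
  refine ⟨f '' {y | ∀ j, y j ≤ b j}, hK.image hf, Set.image_subset_range _ _, ?_⟩
  -- By outer regularity it suffices to bound the open sets around the compact image; each of them
  -- already contains the image of a set with finitely many constraints, of measure above `c`.
  rw [Set.measure_eq_iInf_isOpen]
  refine le_iInf₂ fun U hKU => le_iInf fun hU => ?_
  obtain ⟨i, hi⟩ := exists_forall_lt_le_subset_of_isOpen b (hU.preimage hf)
    (Set.image_subset_iff.1 hKU)
  exact (hb i).le.trans (measure_mono (Set.image_subset_iff.2 hi))

/-- Analytic sets are null measurable for every finite measure. -/
theorem nullMeasurableSet_of_analyticSet {α : Type*} [TopologicalSpace α]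
    [T2Space α] [MeasurableSpace α] [OpensMeasurableSpace α] (μ : Measure α) [IsFiniteMeasure μ]
    [μ.OuterRegular] {s : Set α} (hs : AnalyticSet s) : NullMeasurableSet s μ := by
  rw [AnalyticSet] at hs
  rcases hs with rfl | ⟨f, hf, rfl⟩
  · exact nullMeasurableSet_empty
  rcases eq_or_ne (μ (range f)) 0 with h0 | h0
  · exact NullMeasurableSet.of_null h0
  obtain ⟨c, -, hc, hlim⟩ := exists_seq_strictMono_tendsto' (pos_iff_ne_zero.2 h0)
  choose K hKc hKs hcK using fun n =>
    exists_isCompact_le_measure_of_lt_measure_range μ hf (hc n).2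
  have hLm : MeasurableSet (⋃ n, K n) :=
    MeasurableSet.iUnion fun n => (hKc n).isClosed.measurableSet
  have hLs : (⋃ n, K n) ⊆ range f := iUnion_subset hKs
  have hle : μ (range f) ≤ μ (⋃ n, K n) :=
    le_of_tendsto' hlim fun n => (hcK n).trans (measure_mono (subset_iUnion K n))
  refine hLm.nullMeasurableSet.congr ?_
  exact ae_eq_of_subset_of_measure_ge hLs hle hLm.nullMeasurableSet (measure_ne_top μ _)

/-- Measurable projection: the projection of a measurable set along a standard Borel space is
null measurable for every finite measure. -/
theorem nullMeasurableSet_image_fst {α β : Type*} [MeasurableSpace α] [StandardBorelSpace α]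
    [MeasurableSpace β] [StandardBorelSpace β] (μ : Measure α) [IsFiniteMeasure μ]
    {E : Set (α × β)} (hE : MeasurableSet E) : NullMeasurableSet (Prod.fst '' E) μ := by
  let _ := upgradeStandardBorel α
  let _ := TopologicalSpace.upgradeIsCompletelyMetrizable α
  exact nullMeasurableSet_of_analyticSet μ (hE.analyticSet_image measurable_fst)

end Capacitability

/-! ### Paths observed on a countable grid, their ages and first passage times. -/

section Paths

/-- Observations of a path along the rational grid. -/
abbrev GridPath : Type := ℕ × ℕ → ℝ

/-- The time `j / (n + 1)` that carries the index `(n, j)`. -/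
def gridTime (p : ℕ × ℕ) : ℝ≥0 := p.2 / (p.1 + 1)

/-- The index of the first grid point of mesh `1 / (n + 1)` that lies strictly after `t`. -/
def nextIndex (n : ℕ) (t : ℝ≥0) : ℕ × ℕ := (n, ⌊(n + 1) * t⌋₊ + 1)

/-- The first grid point of mesh `1 / (n + 1)` that lies strictly after `t`. -/
def nextTime (n : ℕ) (t : ℝ≥0) : ℝ≥0 := gridTime (nextIndex n t)

theorem lt_nextTime (n : ℕ) (t : ℝ≥0) : t < nextTime n t := by
  have h : (0 : ℝ≥0) < n + 1 := by positivity
  simp only [nextTime, gridTime, nextIndex]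
  rw [lt_div_iff₀ h, mul_comm]
  exact_mod_cast Nat.lt_floor_add_one ((n + 1) * t)

theorem nextTime_le (n : ℕ) (t : ℝ≥0) : nextTime n t ≤ t + 1 / (n + 1) := by
  have h : (0 : ℝ≥0) < n + 1 := by positivity
  simp only [nextTime, gridTime, nextIndex]
  rw [div_le_iff₀ h, add_mul t, div_mul_cancel₀ _ h.ne', mul_comm t]
  push_cast
  gcongr
  exact Nat.floor_le (by positivity)

theorem tendsto_nextTime (t : ℝ≥0) : Tendsto (fun n => nextTime n t) atTop (𝓝[>] t) := by
  refine tendsto_nhdsWithin_iff.2 ⟨?_, Eventually.of_forall fun n => lt_nextTime n t⟩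
  have h : Tendsto (fun n : ℕ => t + 1 / ((n : ℝ≥0) + 1)) atTop (𝓝 (t + 0)) :=
    tendsto_const_nhds.add tendsto_one_div_add_atTop_nhds_zero_nat
  rw [add_zero] at h
  exact tendsto_of_tendsto_of_tendsto_of_le_of_le tendsto_const_nhds h
    (fun n => (lt_nextTime n t).le) (fun n => nextTime_le n t)

theorem measurable_nextIndex (n : ℕ) : Measurable (nextIndex n) := by
  unfold nextIndex
  fun_prop

theorem measurable_gridTime : Measurable gridTime := measurable_of_countable _

theorem measurable_nextTime (n : ℕ) : Measurable (nextTime n) :=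
  measurable_gridTime.comp (measurable_nextIndex n)

/-- The value at time `t` of the right-continuous path that is observed on the grid. -/
@[irreducible]
def evalPath (y : GridPath) (t : ℝ≥0) : ℝ := limsup (fun n => y (nextIndex n t)) atTop

/-- Measurability is joint in path and time, which permits evaluation at random times. The limsup is
defined for every grid path, regular or not. -/
theorem measurable_evalPath : Measurable fun p : GridPath × ℝ≥0 => evalPath p.1 p.2 := by
  unfold evalPath
  refine Measurable.limsup fun n => ?_
  have h : Measurable fun p : GridPath × (ℕ × ℕ) => p.1 p.2 :=
    measurable_from_prod_countable_left fun q => measurable_pi_apply q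
  exact h.comp (measurable_fst.prodMk ((measurable_nextIndex n).comp measurable_snd))

theorem measurable_evalPath_comp {α : Type*} [MeasurableSpace α] {Y : α → GridPath} {t : α → ℝ≥0}
    (hY : Measurable Y) (ht : Measurable t) : Measurable fun a => evalPath (Y a) (t a) :=
  measurable_evalPath.comp (hY.prodMk ht)

theorem aemeasurable_evalPath_comp {α : Type*} [MeasurableSpace α] {μ : Measure α}
    {Y : α → GridPath} {t : α → ℝ≥0} (hY : AEMeasurable Y μ) (ht : AEMeasurable t μ) :
    AEMeasurable (fun a => evalPath (Y a) (t a)) μ :=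
  measurable_evalPath.comp_aemeasurable (hY.prodMk ht)

theorem evalPath_eq_of_tendsto {y : GridPath} {f : ℝ≥0 → ℝ} (hy : ∀ p, y p = f (gridTime p))
    {t : ℝ≥0} (hf : Tendsto f (𝓝[>] t) (𝓝 (f t))) : evalPath y t = f t := by
  rw [evalPath]
  refine Tendsto.limsup_eq ?_
  simp only [hy]
  exact hf.comp (tendsto_nextTime t)

/-- The time elapsed at `r` since the path was last at or above the level `d`. -/
def pathAge (y : GridPath) (d : ℝ) (r : ℝ≥0) : ℝ≥0∞ :=
  sInf {t | ∃ s : ℝ≥0, t = (s : ℝ≥0∞) ∧ s ≤ r ∧ d ≤ evalPath y (r - s)}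

/-- The first passage time of the path to the half-line `(-∞, a]`. -/
def pathHit (y : GridPath) (a : ℝ) : ℝ≥0∞ :=
  sInf {t | ∃ s : ℝ≥0, t = (s : ℝ≥0∞) ∧ evalPath y s ≤ a}

/-- An infimum of times that satisfy a measurable condition is almost everywhere measurable. -/
theorem aemeasurable_sInf_times {α : Type*} [MeasurableSpace α] [StandardBorelSpace α]
    (μ : Measure α) [IsFiniteMeasure μ] {E : Set (α × ℝ≥0)} (hE : MeasurableSet E) :
    AEMeasurable (fun a => sInf {t : ℝ≥0∞ | ∃ s : ℝ≥0, t = s ∧ (a, s) ∈ E}) μ := by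
  refine NullMeasurable.aemeasurable ?_
  have key : ∀ c : ℝ≥0∞, NullMeasurableSet
      ((fun a => sInf {t : ℝ≥0∞ | ∃ s : ℝ≥0, t = s ∧ (a, s) ∈ E}) ⁻¹' Iio c) μ := by
    intro c
    -- The infimum is below `c` exactly when some admissible time is, so the sublevel set is a
    -- projection along the time axis.
    have h : ((fun a => sInf {t : ℝ≥0∞ | ∃ s : ℝ≥0, t = s ∧ (a, s) ∈ E}) ⁻¹' Iio c) =
        Prod.fst '' (E ∩ {p | (p.2 : ℝ≥0∞) < c}) := by
      ext a
      simp only [Set.mem_preimage, Set.mem_Iio, sInf_lt_iff, Set.mem_image, Set.mem_inter_iff,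
        Set.mem_ofPred_eq, Prod.exists, exists_and_right, exists_eq_right]
      constructor
      · rintro ⟨_, ⟨s, rfl, hs⟩, hc⟩
        exact ⟨s, hs, hc⟩
      · rintro ⟨s, hs, hc⟩
        exact ⟨s, ⟨s, rfl, hs⟩, hc⟩
    rw [h]
    exact nullMeasurableSet_image_fst μ
      (hE.inter (measurableSet_lt (measurable_coe_nnreal_ennreal.comp measurable_snd)
        measurable_const))
  have h : @Measurable (NullMeasurableSpace α μ) _ _ _
      (fun a : α => sInf {t : ℝ≥0∞ | ∃ s : ℝ≥0, t = s ∧ (a, s) ∈ E}) :=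
    measurable_of_Iio key
  exact fun s hs => h hs

/-- The level and the horizon are variables too: the level is random at the last inspection, and the
horizon is random after a first passage. -/
theorem aemeasurable_pathAge (μ : Measure (GridPath × ℝ × ℝ≥0)) [IsFiniteMeasure μ] :
    AEMeasurable (fun p => pathAge p.1 p.2.1 p.2.2) μ := by
  have h1 : MeasurableSet {p : (GridPath × ℝ × ℝ≥0) × ℝ≥0 | p.2 ≤ p.1.2.2} :=
    measurableSet_le measurable_snd measurable_fst.snd.snd
  have h2 : MeasurableSet {p : (GridPath × ℝ × ℝ≥0) × ℝ≥0 |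
      p.1.2.1 ≤ evalPath p.1.1 (p.1.2.2 - p.2)} :=
    measurableSet_le measurable_fst.snd.fst
      (measurable_evalPath_comp measurable_fst.fst (measurable_fst.snd.snd.sub measurable_snd))
  refine (aemeasurable_sInf_times μ (h1.inter h2)).congr (Eventually.of_forall fun p => ?_)
  simp only [pathAge, Set.mem_inter_iff, Set.mem_ofPred_eq]

theorem aemeasurable_pathHit (μ : Measure GridPath) [IsFiniteMeasure μ] (a : ℝ) :
    AEMeasurable (fun y => pathHit y a) μ :=
  aemeasurable_sInf_times μ (E := {p | evalPath p.1 p.2 ≤ a})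
    (measurableSet_le measurable_evalPath measurable_const)

theorem aemeasurable_pathAge_comp {α : Type*} [MeasurableSpace α] {μ : Measure α}
    [IsFiniteMeasure μ] {Y : α → GridPath} {d : α → ℝ} {r : α → ℝ≥0} (hY : AEMeasurable Y μ)
    (hd : AEMeasurable d μ) (hr : AEMeasurable r μ) :
    AEMeasurable (fun a => pathAge (Y a) (d a) (r a)) μ :=
  (aemeasurable_pathAge _).comp_aemeasurable (hY.prodMk (hd.prodMk hr))

/-- The path with all observations from time `c` on erased. -/
def cutPath (c : ℝ≥0) (y : GridPath) : GridPath :=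
  open Classical in fun p => if gridTime p < c then y p else 0

/-- Evaluation at `t` looks at grid points just after `t`, which is why `t < c` must be strict. -/
theorem evalPath_cutPath {c t : ℝ≥0} (h : t < c) (y : GridPath) :
    evalPath (cutPath c y) t = evalPath y t := by
  rw [evalPath, evalPath]
  refine limsup_congr ?_
  filter_upwards [((tendsto_nextTime t).mono_right nhdsWithin_le_nhds).eventually
    (Iio_mem_nhds h)] with n hn
  exact if_pos hn

theorem pathHit_lt_iff {y : GridPath} {a : ℝ} {b : ℝ≥0∞} :
    pathHit y a < b ↔ ∃ s : ℝ≥0, (s : ℝ≥0∞) < b ∧ evalPath y s ≤ a := by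
  simp only [pathHit, sInf_lt_iff]
  constructor
  · rintro ⟨_, ⟨s, rfl, hs⟩, hc⟩
    exact ⟨s, hc, hs⟩
  · rintro ⟨s, hc, hs⟩
    exact ⟨s, ⟨s, rfl, hs⟩, hc⟩

theorem pathHit_cutPath_lt_iff {c : ℝ≥0} {y : GridPath} {a : ℝ} {b : ℝ≥0∞} (hb : b ≤ c) :
    pathHit (cutPath c y) a < b ↔ pathHit y a < b := by
  rw [pathHit_lt_iff, pathHit_lt_iff]
  refine exists_congr fun s => and_congr_right fun hs => ?_
  rw [evalPath_cutPath (ENNReal.coe_lt_coe.1 (hs.trans_le hb))]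

/-- Whether the first passage happens in a set of times before `c` is decided by the path up to
time `c`. -/
theorem pathHit_cutPath_mem_iff {c : ℝ≥0} {y : GridPath} {a : ℝ} {C : Set ℝ≥0∞}
    (hC : C ⊆ Iio (c : ℝ≥0∞)) : pathHit (cutPath c y) a ∈ C ↔ pathHit y a ∈ C := by
  by_cases h : pathHit y a < c
  · have h' := (pathHit_cutPath_lt_iff le_rfl).2 h
    have : pathHit (cutPath c y) a = pathHit y a := by
      refine le_antisymm (le_of_forall_gt fun b hb => ?_) (le_of_forall_gt fun b hb => ?_)
      · rcases le_total b c with hbc | hbc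
        · exact (pathHit_cutPath_lt_iff hbc).2 hb
        · exact h'.trans_le hbc
      · rcases le_total b c with hbc | hbc
        · exact (pathHit_cutPath_lt_iff hbc).1 hb
        · exact h.trans_le hbc
    rw [this]
  · have h' := mt (pathHit_cutPath_lt_iff le_rfl).1 h
    exact ⟨fun hm => absurd (hC hm) h', fun hm => absurd (hC hm) h⟩

end Paths

/-! ### The Markov property at a fixed time. -/

section Markov

/-- Finitely many times can be listed in increasing order, starting from `0`. -/
theorem exists_monotone_seq_cover (I : Finset ℝ≥0) :
    ∃ (m : ℕ) (t : ℕ → ℝ≥0), Monotone t ∧ t 0 = 0 ∧ ∀ s ∈ I, ∃ i ≤ m, t i = s := by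
  let J := insert 0 I
  have hJ : 0 < J.card := Finset.card_pos.2 ⟨0, Finset.mem_insert_self _ _⟩
  let e := J.orderEmbOfFin rfl
  refine ⟨J.card - 1, fun i => e ⟨min i (J.card - 1), by omega⟩, ?_, ?_, ?_⟩
  · intro i j hij
    exact e.monotone (by simp only [Fin.mk_le_mk]; omega)
  · have h0 : (0 : ℝ≥0) ∈ range e := by
      simp only [e, Finset.range_orderEmbOfFin]
      exact Finset.mem_insert_self _ _
    obtain ⟨i, hi⟩ := h0
    refine le_antisymm ?_ zero_le
    rw [← hi]
    exact e.monotone (by rw [Fin.le_def]; simp)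
  · intro s hs
    have h0 : s ∈ range e := by
      simp only [e, Finset.range_orderEmbOfFin]
      exact Finset.mem_insert_of_mem hs
    obtain ⟨i, hi⟩ := h0
    refine ⟨i, by omega, ?_⟩
    rw [← hi]
    refine congrArg e (Fin.ext ?_)
    have := i.2
    change min (i : ℕ) (J.card - 1) = i
    omega

variable {Ω : Type*} [MeasurableSpace Ω] {P : Measure Ω} {X : ℝ≥0 → Ω → ℝ}

/-- The increments of the path after time `c`. -/
def incrementAfter (X : ℝ≥0 → Ω → ℝ) (c : ℝ≥0) (t : ℝ≥0) (ω : Ω) : ℝ := X (c + t) ω - X c ω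

theorem IsLevyProcess.measurable_sub (hX : IsLevyProcess X P) (s t : ℝ≥0) :
    Measurable fun ω => X s ω - X t ω :=
  (hX.measurable s).sub (hX.measurable t)

theorem IsLevyProcess.measurable_incrementAfter (hX : IsLevyProcess X P) (c t : ℝ≥0) :
    Measurable (incrementAfter X c t) :=
  hX.measurable_sub _ _

/-- The law of the increments of a Lévy process along a sequence of times depends only on the
time lags. -/
theorem IsLevyProcess.map_increments (hX : IsLevyProcess X P) (c : ℝ≥0) {t : ℕ → ℝ≥0}
    (ht : Monotone t) (m : ℕ) :
    P.map (fun ω (j : Fin m) => X (c + t (j + 1)) ω - X (c + t j) ω) =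
      Measure.pi fun j : Fin m => P.map (X (t (j + 1) - t j)) := by
  have hind := (hX.indepIncrements.nat (t := fun i => c + t i)
    (fun i j hij => add_le_add_right (ht hij) c)).precomp
    (g := fun j : Fin m => (j : ℕ)) Fin.val_injective
  rw [hind.map_fun_eq_pi_map fun j => (hX.measurable_sub _ _).aemeasurable]
  congr 1
  ext1 j
  have h := (hX.stationaryIncrements (c + t j) (t (j + 1) - t j)).map_eq
  rw [add_assoc, add_tsub_cancel_of_le (ht (Nat.le_succ j))] at h
  exact h

variable [IsProbabilityMeasure P]

/-- It suffices to compare finite-dimensional laws. Along an increasing list of times starting at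
`0`, the increments after `c` are partial sums of successive increments, whose joint law does not
involve `c`. -/
theorem IsLevyProcess.map_incrementAfter (hX : IsLevyProcess X P) (c : ℝ≥0) :
    P.map (fun ω t => incrementAfter X c t ω) = P.map (fun ω t => X t ω) := by
  have hm : ∀ c, AEMeasurable (fun ω t => incrementAfter X c t ω) P := fun c =>
    (measurable_pi_lambda _ fun t => hX.measurable_incrementAfter c t).aemeasurable
  have h0 : P.map (fun ω t => X t ω) = P.map (fun ω t => incrementAfter X 0 t ω) := by
    refine Measure.map_congr ?_
    filter_upwards [hX.start] with ω hω
    ext t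
    simp [incrementAfter, hω]
  rw [h0, map_eq_iff_forall_finset_map_restrict_eq (hm c) (hm 0)]
  intro I
  obtain ⟨m, t, ht, ht0, hI⟩ := exists_monotone_seq_cover I
  choose! i hi hti using hI
  let G : (Fin m → ℝ) → I → ℝ := fun ξ s => ∑ j : Fin m, if (j : ℕ) < i s then ξ j else 0
  have hG : Measurable G := by
    refine measurable_pi_lambda _ fun s => Finset.measurable_sum _ fun j _ => ?_
    split_ifs
    · exact measurable_pi_apply j
    · exact measurable_const
  have key : ∀ c, P.map (fun ω => I.restrict fun t => incrementAfter X c t ω) =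
      (Measure.pi fun j : Fin m => P.map (X (t (j + 1) - t j))).map G := by
    intro c
    rw [← hX.map_increments c ht m, Measure.map_map hG (measurable_pi_lambda _ fun j =>
      hX.measurable_sub _ _)]
    congr 1
    ext ω s
    simp only [Finset.restrict, incrementAfter, Function.comp, G]
    rw [Fin.sum_univ_eq_sum_range
      (fun j => if j < i s then X (c + t (j + 1)) ω - X (c + t j) ω else 0) m,
      ← Finset.sum_filter]
    have : (Finset.range m).filter (· < i s) = Finset.range (i s) := by
      ext j
      have := hi s s.2
      simp only [Finset.mem_filter, Finset.mem_range]
      omega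
    rw [this, Finset.sum_range_sub (fun j => X (c + t j) ω), hti s s.2, ht0, add_zero]
  rw [key, key]

/-- The increments of a Lévy process after a fixed time are independent of its past. -/
theorem IsLevyProcess.indepFun_incrementAfter (hX : IsLevyProcess X P) (c : ℝ≥0) :
    IndepFun (fun ω (s : Iic c) => X s ω) (fun ω t => incrementAfter X c t ω) P := by
  -- Subtracting `X 0` makes the past a family of sums of increments; since `X 0 = 0` almost surely,
  -- the subtraction is undone at the end.
  have hstart : IndepFun (fun ω (s : Iic c) => X s ω - X 0 ω)
      (fun ω t => incrementAfter X c t ω) P := by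
    refine IndepFun.process_indepFun_process
      (fun s => hX.measurable_sub _ _)
      (fun t => hX.measurable_incrementAfter c t) fun I J => ?_
    classical
    obtain ⟨m, t, ht, ht0, hI⟩ := exists_monotone_seq_cover
      (insert c (I.image (fun s : Iic c => (s : ℝ≥0)) ∪ J.image (fun t => c + t)))
    choose! i hi hti using hI
    have hic := hti c (by simp)
    have hind := (hX.indepIncrements.nat ht).indepFun_finset (Finset.range (i c))
      (Finset.Ico (i c) (m + 1)) (by
        rw [Finset.disjoint_left]
        intro j
        simp only [Finset.mem_range, Finset.mem_Ico]
        omega) (fun j => hX.measurable_sub _ _)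
    -- Past values sum increments with index below `i c`, future ones those with index from `i c`
    -- on. The caps by `min` and `max` spare a comparison of indices: `t` is monotone, so they
    -- become a minimum and a maximum of times.
    let f : (Finset.range (i c) → ℝ) → I → ℝ := fun ξ s =>
      ∑ j : Finset.range (i c), if (j : ℕ) < min (i s) (i c) then ξ j else 0
    let g : (Finset.Ico (i c) (m + 1) → ℝ) → J → ℝ := fun ξ s =>
      ∑ j : Finset.Ico (i c) (m + 1), if (j : ℕ) < max (i (c + s)) (i c) then ξ j else 0
    have hf : Measurable f := by
      refine measurable_pi_lambda _ fun s => Finset.measurable_sum _ fun j _ => ?_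
      split_ifs
      · exact measurable_pi_apply j
      · exact measurable_const
    have hg : Measurable g := by
      refine measurable_pi_lambda _ fun s => Finset.measurable_sum _ fun j _ => ?_
      split_ifs
      · exact measurable_pi_apply j
      · exact measurable_const
    convert hind.comp hf hg using 1
    · ext ω s
      simp only [Function.comp, f]
      rw [Finset.sum_coe_sort (Finset.range (i c))
        (fun j => if j < min (i s) (i c) then X (t (j + 1)) ω - X (t j) ω else 0),
        ← Finset.sum_filter]
      have h1 : (Finset.range (i c)).filter (· < min (i s) (i c)) =
          Finset.range (min (i s) (i c)) := by
        ext j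
        simp only [Finset.mem_filter, Finset.mem_range]
        omega
      have h2 : t (i s) = s := hti s (by
        refine Finset.mem_insert_of_mem (Finset.mem_union_left _ ?_)
        exact Finset.mem_image_of_mem (fun s : Iic c => (s : ℝ≥0)) s.2)
      have h3 : ((s : Iic c) : ℝ≥0) ≤ c := (s : Iic c).2
      rw [h1, Finset.sum_range_sub (fun j => X (t j) ω), ht0, ht.map_min, h2, hic, min_eq_left h3]
    · ext ω s
      simp only [Function.comp, g, incrementAfter]
      rw [Finset.sum_coe_sort (Finset.Ico (i c) (m + 1))
        (fun j => if j < max (i (c + s)) (i c) then X (t (j + 1)) ω - X (t j) ω else 0),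
        ← Finset.sum_filter]
      have hmem : c + (s : ℝ≥0) ∈
          insert c (I.image (fun s : Iic c => (s : ℝ≥0)) ∪ J.image (fun t => c + t)) :=
        Finset.mem_insert_of_mem (Finset.mem_union_right _
          (Finset.mem_image_of_mem (fun t => c + t) s.2))
      have h1 : (Finset.Ico (i c) (m + 1)).filter (· < max (i (c + s)) (i c)) =
          Finset.Ico (i c) (max (i (c + s)) (i c)) := by
        ext j
        have := hi _ hmem
        have := hi c (by simp)
        simp only [Finset.mem_filter, Finset.mem_Ico]
        omega
      rw [h1, Finset.sum_Ico_sub (fun j => X (t j) ω) (le_max_right _ _), ht.map_max,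
        hti _ hmem, hic, max_eq_left (le_add_of_nonneg_right zero_le)]
  refine hstart.congr ?_ .rfl
  filter_upwards [hX.start] with ω hω
  ext s
  simp [hω]

end Markov

/-! ### The strong Markov property at first passage times. -/

section StrongMarkov

variable {Ω : Type*} {X : ℝ≥0 → Ω → ℝ}

/-- The increments after time `c`, observed on the grid. -/
def shiftedPath (X : ℝ≥0 → Ω → ℝ) (c : ℝ≥0) (ω : Ω) : GridPath :=
  fun p => incrementAfter X c (gridTime p) ω

/-- The path observed on the grid. -/
def observe (X : ℝ≥0 → Ω → ℝ) (ω : Ω) : GridPath := fun p => X (gridTime p) ω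

theorem tendsto_add_left_nhdsGT (c t : ℝ≥0) :
    Tendsto (fun s => c + s) (𝓝[>] t) (𝓝[>] (c + t)) := by
  refine tendsto_nhdsWithin_iff.2 ⟨?_, ?_⟩
  · exact ((continuous_const.add continuous_id).tendsto t).mono_left nhdsWithin_le_nhds
  · filter_upwards [self_mem_nhdsWithin] with s hs
    exact add_lt_add_right hs c

theorem tendsto_shiftedPath_nextTime {ω : Ω}
    (hω : ∀ t, ContinuousWithinAt (fun s => X s ω) (Ioi t) t) (t : ℝ≥0) :
    Tendsto (fun n => shiftedPath X (nextTime n t) ω) atTop (𝓝 (shiftedPath X t ω)) := by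
  rw [tendsto_pi_nhds]
  intro p
  refine Tendsto.sub ?_ ((hω t).tendsto.comp (tendsto_nextTime t))
  have h := (hω (gridTime p + t)).tendsto.comp
    ((tendsto_add_left_nhdsGT (gridTime p) t).comp (tendsto_nextTime t))
  simpa only [Function.comp_def, add_comm] using h

variable [MeasurableSpace Ω] {P : Measure Ω}

/-- The law of the path observed on the grid. -/
def pathLaw (X : ℝ≥0 → Ω → ℝ) (P : Measure Ω) : Measure GridPath := P.map (observe X)

theorem IsLevyProcess.measurable_observe (hX : IsLevyProcess X P) : Measurable (observe X) :=
  measurable_pi_lambda _ fun _ => hX.measurable _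

theorem IsLevyProcess.measurable_shiftedPath (hX : IsLevyProcess X P) (c : ℝ≥0) :
    Measurable (shiftedPath X c) :=
  measurable_pi_lambda _ fun _ => hX.measurable_incrementAfter _ _

theorem IsLevyProcess.ae_evalPath_observe (hX : IsLevyProcess X P) :
    ∀ᵐ ω ∂P, ∀ t, evalPath (observe X ω) t = X t ω := by
  filter_upwards [hX.cadlag] with ω hω t
  exact evalPath_eq_of_tendsto (f := fun t => X t ω) (fun p => rfl) (hω t).1

theorem IsLevyProcess.ae_evalPath_shiftedPath (hX : IsLevyProcess X P) :
    ∀ᵐ ω ∂P, ∀ c t, evalPath (shiftedPath X c ω) t = X (c + t) ω - X c ω := by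
  filter_upwards [hX.cadlag] with ω hω c t
  refine evalPath_eq_of_tendsto (f := fun t => X (c + t) ω - X c ω) (fun p => rfl) ?_
  exact (((hω (c + t)).1).tendsto.comp (tendsto_add_left_nhdsGT c t)).sub_const _

/-- `X` is only assumed measurable at each fixed time; at a random time it agrees almost surely with
`evalPath` of the observed path. -/
theorem IsLevyProcess.aemeasurable_shiftedPath_random (hX : IsLevyProcess X P) {T : Ω → ℝ≥0}
    (hT : AEMeasurable T P) : AEMeasurable (fun ω => shiftedPath X (T ω) ω) P := by
  refine aemeasurable_pi_lambda _ fun p => ?_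
  have hO := hX.measurable_observe.aemeasurable (μ := P)
  refine ((aemeasurable_evalPath_comp hO (hT.add_const (gridTime p))).sub
    (aemeasurable_evalPath_comp hO hT)).congr ?_
  filter_upwards [hX.ae_evalPath_observe] with ω hω
  simp only [Pi.sub_apply, hω]
  rfl

/-- Passage events are only known to be null measurable; a measurable superset that is almost
everywhere equal carries the product formula over to them. -/
theorem measure_inter_preimage_eq_mul₀ {α β : Type*} [MeasurableSpace α] [MeasurableSpace β]
    {U : Ω → α} {V : Ω → β} (h : IndepFun U V P) (hU : Measurable U)
    {E : Set α} {F : Set β} (hE : NullMeasurableSet E (P.map U)) (hF : MeasurableSet F) :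
    P (U ⁻¹' E ∩ V ⁻¹' F) = P (U ⁻¹' E) * P (V ⁻¹' F) := by
  obtain ⟨E', -, hE', hEE'⟩ := hE.exists_measurable_superset_ae_eq
  have h1 : U ⁻¹' E =ᵐ[P] U ⁻¹' E' :=
    (hU.quasiMeasurePreserving P).preimage_ae_eq hEE'.symm
  rw [measure_congr h1, measure_congr (h1.inter (ae_eq_refl (V ⁻¹' F)))]
  exact h.measure_inter_preimage_eq_mul _ _ hE' hF

variable [IsProbabilityMeasure P]

theorem IsLevyProcess.isProbabilityMeasure_pathLaw (hX : IsLevyProcess X P) :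
    IsProbabilityMeasure (pathLaw X P) :=
  Measure.isProbabilityMeasure_map hX.measurable_observe.aemeasurable

theorem IsLevyProcess.map_shiftedPath (hX : IsLevyProcess X P) (c : ℝ≥0) :
    P.map (shiftedPath X c) = pathLaw X P := by
  have hG : Measurable fun (f : ℝ≥0 → ℝ) (p : ℕ × ℕ) => f (gridTime p) :=
    measurable_pi_lambda _ fun p => measurable_pi_apply _
  have h := congrArg (Measure.map fun (f : ℝ≥0 → ℝ) (p : ℕ × ℕ) => f (gridTime p))
    (hX.map_incrementAfter c)
  rwa [Measure.map_map hG (measurable_pi_lambda _ fun t => hX.measurable_incrementAfter c t),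
    Measure.map_map hG (measurable_pi_lambda _ fun t => hX.measurable t)] at h

theorem IsLevyProcess.indepFun_shiftedPath (hX : IsLevyProcess X P) (c : ℝ≥0) :
    IndepFun (fun ω (s : Iic c) => X s ω) (shiftedPath X c) P :=
  (hX.indepFun_incrementAfter c).comp (φ := id) measurable_id
    (ψ := fun (f : ℝ≥0 → ℝ) (p : ℕ × ℕ) => f (gridTime p))
    (measurable_pi_lambda _ fun _ => measurable_pi_apply _)

theorem IsLevyProcess.indepFun_cutPath_shiftedPath (hX : IsLevyProcess X P) (c : ℝ≥0) :
    IndepFun (fun ω => cutPath c (observe X ω)) (shiftedPath X c) P := by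
  classical
  let G : (Iic c → ℝ) → GridPath := fun f p =>
    if h : gridTime p < c then f ⟨gridTime p, h.le⟩ else 0
  have hG : Measurable G := by
    refine measurable_pi_lambda _ fun p => ?_
    by_cases h : gridTime p < c
    · simp only [G, dif_pos h]
      exact measurable_pi_apply _
    · simp only [G, dif_neg h]
      exact measurable_const
  suffices hc : (fun ω => cutPath c (observe X ω)) = G ∘ fun ω (s : Iic c) => X s ω by
    rw [hc]
    exact (hX.indepFun_shiftedPath c).comp hG measurable_id
  ext ω p
  simp only [cutPath, Function.comp, G, observe]
  by_cases h : gridTime p < c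
  · rw [if_pos h, dif_pos h]
  · rw [if_neg h, dif_neg h]

/-- Passage at a time in `C`, all before `c`, is decided by the path cut at `c`, which is
independent of the increments after `c`. -/
theorem IsLevyProcess.measure_pathHit_mem_inter (hX : IsLevyProcess X P) (a : ℝ) {c : ℝ≥0}
    {C : Set ℝ≥0∞} (hC : MeasurableSet C) (hCc : C ⊆ Iio (c : ℝ≥0∞)) {F : Set GridPath}
    (hF : MeasurableSet F) :
    P ((fun ω => pathHit (observe X ω) a) ⁻¹' C ∩ shiftedPath X c ⁻¹' F) =
      P ((fun ω => pathHit (observe X ω) a) ⁻¹' C) * pathLaw X P F := by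
  have hm : Measurable fun ω => cutPath c (observe X ω) := by
    refine measurable_pi_lambda _ fun p => ?_
    by_cases h : gridTime p < c
    · simp only [cutPath, if_pos h]
      exact hX.measurable _
    · simp only [cutPath, if_neg h]
      exact measurable_const
  have h1 : (fun ω => pathHit (observe X ω) a) ⁻¹' C =
      (fun ω => cutPath c (observe X ω)) ⁻¹' ((fun y => pathHit y a) ⁻¹' C) := by
    ext ω
    exact (pathHit_cutPath_mem_iff hCc).symm
  have := Measure.isProbabilityMeasure_map (μ := P) hm.aemeasurable
  rw [h1, measure_inter_preimage_eq_mul₀ (hX.indepFun_cutPath_shiftedPath c) hm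
    ((aemeasurable_pathHit _ a).nullMeasurable hC) hF, ← hX.map_shiftedPath c,
    Measure.map_apply (hX.measurable_shiftedPath c) hF]

theorem IsLevyProcess.aemeasurable_pathHit_observe (hX : IsLevyProcess X P) (a : ℝ) :
    AEMeasurable (fun ω => pathHit (observe X ω) a) P := by
  have := hX.isProbabilityMeasure_pathLaw
  exact (aemeasurable_pathHit (pathLaw X P) a).comp_aemeasurable
    hX.measurable_observe.aemeasurable

/-- Rounding the passage time up to the grid leaves countably many deterministic values, each
strictly later than the passage; the fixed-time Markov property applies to each slice. -/
theorem IsLevyProcess.map_shiftedPath_nextTime (hX : IsLevyProcess X P) (a : ℝ) (n : ℕ)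
    {C : Set ℝ≥0∞} (hC : MeasurableSet C) (hC' : ∞ ∉ C) :
    (P.restrict ((fun ω => pathHit (observe X ω) a) ⁻¹' C)).map
        (fun ω => shiftedPath X (nextTime n (pathHit (observe X ω) a).toNNReal) ω) =
      P ((fun ω => pathHit (observe X ω) a) ⁻¹' C) • pathLaw X P := by
  set H : Ω → ℝ≥0∞ := fun ω => pathHit (observe X ω) a with hHdef
  have hH : AEMeasurable H P := hX.aemeasurable_pathHit_observe a
  have hZ : AEMeasurable (fun ω => shiftedPath X (nextTime n (H ω).toNNReal) ω) P :=
    hX.aemeasurable_shiftedPath_random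
      ((measurable_nextTime n).comp_aemeasurable hH.ennreal_toNNReal)
  let Cj : ℕ → Set ℝ≥0∞ := fun j => C ∩ (fun v => ⌊((n : ℝ≥0) + 1) * v.toNNReal⌋₊) ⁻¹' {j}
  have hCj : ∀ j, MeasurableSet (Cj j) := fun j => hC.inter
    ((Nat.measurable_floor.comp (measurable_const.mul ENNReal.measurable_toNNReal))
      (measurableSet_singleton j))
  have hCjd : Pairwise (Function.onFun Disjoint Cj) := by
    intro i j hij
    rw [Function.onFun, Set.disjoint_left]
    rintro v ⟨-, hi⟩ ⟨-, hj⟩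
    exact hij (hi.symm.trans hj)
  have hCU : H ⁻¹' C = ⋃ j, H ⁻¹' Cj j := by
    rw [← preimage_iUnion]
    congr 1
    ext v
    simp [Cj]
  have hnext : ∀ j, ∀ v ∈ Cj j, nextTime n v.toNNReal = gridTime (n, j + 1) := by
    rintro j v ⟨-, hv⟩
    rw [nextTime, nextIndex, show ⌊((n : ℝ≥0) + 1) * v.toNNReal⌋₊ = j from hv]
  have hsub : ∀ j, Cj j ⊆ Iio (gridTime (n, j + 1) : ℝ≥0∞) := by
    intro j v hv
    -- An infinite passage time has to be excluded, since `toNNReal` would send it to `0`.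
    have hne : v ≠ ∞ := fun h => hC' (h ▸ hv.1)
    rw [mem_Iio, ← hnext j v hv, ← ENNReal.coe_toNNReal hne]
    exact ENNReal.coe_lt_coe.2 (lt_nextTime _ _)
  ext F hF
  rw [Measure.map_apply_of_aemeasurable hZ.restrict hF,
    Measure.restrict_apply₀ ((hZ.restrict).nullMeasurable hF), hCU, inter_iUnion,
    measure_iUnion₀, Measure.smul_apply, smul_eq_mul, measure_iUnion₀, ← ENNReal.tsum_mul_right]
  · refine tsum_congr fun j => ?_
    rw [← hX.measure_pathHit_mem_inter a (hCj j) (hsub j) hF, inter_comm]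
    congr 1
    ext ω
    simp only [mem_inter_iff, mem_preimage]
    refine and_congr_right fun hω => ?_
    rw [hnext j _ hω]
  · intro i j hij
    exact ((hCjd hij).preimage H).aedisjoint
  · exact fun j => hH.nullMeasurable (hCj j)
  · intro i j hij
    exact (((hCjd hij).preimage H).mono inter_subset_right inter_subset_right).aedisjoint
  · exact fun j => (hZ.nullMeasurable hF).inter (hH.nullMeasurable (hCj j))

/-- The strong Markov property at a first passage time. -/
theorem IsLevyProcess.map_shiftedPath_pathHit (hX : IsLevyProcess X P) (a : ℝ)
    {C : Set ℝ≥0∞} (hC : MeasurableSet C) (hC' : ∞ ∉ C) :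
    (P.restrict ((fun ω => pathHit (observe X ω) a) ⁻¹' C)).map
        (fun ω => shiftedPath X (pathHit (observe X ω) a).toNNReal ω) =
      P ((fun ω => pathHit (observe X ω) a) ⁻¹' C) • pathLaw X P := by
  have hL := hX.isProbabilityMeasure_pathLaw
  have hH : AEMeasurable (fun ω => pathHit (observe X ω) a) P := hX.aemeasurable_pathHit_observe a
  have hZ : AEMeasurable (fun ω => shiftedPath X (pathHit (observe X ω) a).toNNReal ω) P :=
    hX.aemeasurable_shiftedPath_random hH.ennreal_toNNReal
  have hZn : ∀ n, AEMeasurable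
      (fun ω => shiftedPath X (nextTime n (pathHit (observe X ω) a).toNNReal) ω) P := fun n =>
    hX.aemeasurable_shiftedPath_random
      ((measurable_nextTime n).comp_aemeasurable hH.ennreal_toNNReal)
  let _ := TopologicalSpace.upgradeIsCompletelyMetrizable GridPath
  have : IsFiniteMeasure (P ((fun ω => pathHit (observe X ω) a) ⁻¹' C) • pathLaw X P) :=
    Measure.smul_finite _ (measure_ne_top _ _)
  -- Against a bounded continuous `g`, the rounded times all give the same integral. As the mesh
  -- tends to `0` they decrease onto the passage time from the right, and right-continuity with
  -- dominated convergence identifies the limit.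
  refine ext_of_forall_integral_eq_of_IsFiniteMeasure fun g => ?_
  rw [integral_map hZ.restrict g.continuous.aestronglyMeasurable]
  have hlim := tendsto_integral_of_dominated_convergence
    (μ := P.restrict ((fun ω => pathHit (observe X ω) a) ⁻¹' C))
    (F := fun n ω => g (shiftedPath X (nextTime n (pathHit (observe X ω) a).toNNReal) ω))
    (f := fun ω => g (shiftedPath X (pathHit (observe X ω) a).toNNReal ω)) (fun _ => ‖g‖)
    (fun n => g.continuous.aestronglyMeasurable.comp_aemeasurable (hZn n).restrict)
    (integrable_const _) (fun n => Eventually.of_forall fun ω => g.norm_coe_le_norm _)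
    (by
      filter_upwards [ae_restrict_of_ae hX.cadlag] with ω hω
      exact (g.continuous.tendsto _).comp (tendsto_shiftedPath_nextTime (fun t => (hω t).1) _))
  refine tendsto_nhds_unique hlim ?_
  refine Tendsto.congr (fun n => ?_) tendsto_const_nhds
  rw [← hX.map_shiftedPath_nextTime a n hC hC',
    integral_map (hZn n).restrict g.continuous.aestronglyMeasurable]

end StrongMarkov

/-! ### Disintegration of restricted product laws. -/

section Mixture

variable {α β Ω : Type*} [MeasurableSpace α] [MeasurableSpace β] [MeasurableSpace Ω]

theorem aemeasurable_measure_section (ρ : Measure α) [SFinite ρ] (μ : Measure β) [SFinite μ]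
    {E : Set (α × β)} (hE : NullMeasurableSet E (ρ.prod μ)) :
    AEMeasurable (fun u => μ (Prod.mk u ⁻¹' E)) ρ := by
  obtain ⟨E', -, hE', hEE'⟩ := hE.exists_measurable_superset_ae_eq
  refine (measurable_measure_prodMk_left (ν := μ) hE').aemeasurable.congr ?_
  filter_upwards [Measure.ae_ae_of_ae_prod (μ := ρ) (ν := μ) hEE'] with u hu
  exact measure_congr hu

theorem prod_apply₀ (ρ : Measure α) [SFinite ρ] (μ : Measure β) [SFinite μ]
    {E : Set (α × β)} (hE : NullMeasurableSet E (ρ.prod μ)) :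
    ρ.prod μ E = ∫⁻ u, μ (Prod.mk u ⁻¹' E) ∂ρ := by
  obtain ⟨E', -, hE', hEE'⟩ := hE.exists_measurable_superset_ae_eq
  rw [← measure_congr hEE', Measure.prod_apply hE']
  refine lintegral_congr_ae ?_
  filter_upwards [Measure.ae_ae_of_ae_prod hEE'] with u hu
  exact measure_congr hu

theorem map_fst_restrict_prod (ρ : Measure α) [SFinite ρ] (μ : Measure β) [SFinite μ]
    {S : Set (α × β)} (hS : MeasurableSet S) :
    ((ρ.prod μ).restrict S).map Prod.fst = ρ.withDensity fun u => μ (Prod.mk u ⁻¹' S) := by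
  ext A hA
  rw [Measure.map_apply measurable_fst hA, Measure.restrict_apply (measurable_fst hA),
    Measure.prod_apply ((measurable_fst hA).inter hS), withDensity_apply _ hA,
    ← lintegral_indicator hA]
  refine lintegral_congr fun u => ?_
  by_cases hu : u ∈ A
  · rw [indicator_of_mem hu]
    congr 1
    ext v
    simp [hu]
  · rw [indicator_of_notMem hu]
    convert measure_empty (μ := μ)
    ext v
    simp [hu]

/-- Disintegration of a product measure that is restricted to a set `S`, along the first
coordinate: the second one then has the law `μ` conditioned on the section of `S`. -/
theorem prod_restrict_apply_eq_lintegral_cond (ρ : Measure α) [SFinite ρ] (μ : Measure β)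
    [IsFiniteMeasure μ] {S E : Set (α × β)} (hS : MeasurableSet S)
    (hE : NullMeasurableSet E (ρ.prod μ)) :
    (ρ.prod μ).restrict S E =
      ∫⁻ u, μ[|Prod.mk u ⁻¹' S] (Prod.mk u ⁻¹' E) ∂(((ρ.prod μ).restrict S).map Prod.fst) := by
  have hg := measurable_measure_prodMk_left (ν := μ) hS
  have hSE : NullMeasurableSet (S ∩ E) (ρ.prod μ) := hS.nullMeasurableSet.inter hE
  have hcond : ∀ u, μ[|Prod.mk u ⁻¹' S] (Prod.mk u ⁻¹' E) =
      (μ (Prod.mk u ⁻¹' S))⁻¹ * μ (Prod.mk u ⁻¹' (S ∩ E)) := fun u =>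
    cond_apply (measurable_prodMk_left hS) μ _
  have hf : AEMeasurable (fun u => μ[|Prod.mk u ⁻¹' S] (Prod.mk u ⁻¹' E)) ρ := by
    simp only [hcond]
    exact hg.inv.aemeasurable.mul (aemeasurable_measure_section ρ μ hSE)
  rw [map_fst_restrict_prod ρ μ hS,
    lintegral_withDensity_eq_lintegral_mul₀ hg.aemeasurable hf,
    Measure.restrict_apply₀ (hE.mono_ac Measure.restrict_le_self.absolutelyContinuous), inter_comm,
    prod_apply₀ ρ μ hSE]
  refine lintegral_congr fun u => ?_
  -- The density of the first marginal cancels the normalisation of the conditional law; on null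
  -- sections both sides vanish.
  rw [Pi.mul_apply, mul_comm, cond_mul_eq_inter (measurable_prodMk_left hS)]
  rfl

/-- If `(U, V)` has a product law under `ν`, then the law of `V` under `ν` restricted to
`(U, V) ∈ S` is a mixture of conditioned laws. -/
theorem restrict_apply_eq_lintegral_cond {ν : Measure Ω} [IsFiniteMeasure ν] {μ : Measure β}
    [IsFiniteMeasure μ] {U : Ω → α} {V : Ω → β} (hU : AEMeasurable U ν) (hV : AEMeasurable V ν)
    (hprod : ν.map (fun ω => (U ω, V ω)) = (ν.map U).prod μ) {S E : Set (α × β)}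
    (hS : MeasurableSet S) (hE : NullMeasurableSet E ((ν.map U).prod μ)) :
    ν.restrict ((fun ω => (U ω, V ω)) ⁻¹' S) ((fun ω => (U ω, V ω)) ⁻¹' E) =
      ∫⁻ u, μ[|Prod.mk u ⁻¹' S] (Prod.mk u ⁻¹' E)
        ∂((ν.restrict ((fun ω => (U ω, V ω)) ⁻¹' S)).map U) := by
  have hW : AEMeasurable (fun ω => (U ω, V ω)) ν := hU.prodMk hV
  have hmap : (ν.restrict ((fun ω => (U ω, V ω)) ⁻¹' S)).map (fun ω => (U ω, V ω)) =
      ((ν.map U).prod μ).restrict S := by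
    rw [← hprod, Measure.restrict_map_of_aemeasurable hW hS]
  have hE' : NullMeasurableSet E
      ((ν.restrict ((fun ω => (U ω, V ω)) ⁻¹' S)).map (fun ω => (U ω, V ω))) := by
    rw [hmap]
    exact hE.mono_ac Measure.restrict_le_self.absolutelyContinuous
  have hfst : (ν.restrict ((fun ω => (U ω, V ω)) ⁻¹' S)).map U =
      (((ν.map U).prod μ).restrict S).map Prod.fst := by
    rw [← hmap, AEMeasurable.map_map_of_aemeasurable measurable_fst.aemeasurable hW.restrict]
    rfl
  rw [hfst, ← prod_restrict_apply_eq_lintegral_cond _ μ hS hE, ← hmap,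
    Measure.map_apply₀ hW.restrict hE']

/-- The joint law of independent variables on an event that is determined by the first one. -/
theorem map_restrict_prodMk_of_indepFun {P : Measure Ω} [IsFiniteMeasure P] {γ : Type*}
    [MeasurableSpace γ] {U : Ω → γ} {V : Ω → β} (h : IndepFun U V P) (hU : Measurable U)
    (hV : Measurable V) {φ : γ → α} (hφ : Measurable φ) {A : Set γ} (hA : MeasurableSet A) :
    (P.restrict (U ⁻¹' A)).map (fun ω => (φ (U ω), V ω)) =
      ((P.restrict (U ⁻¹' A)).map (fun ω => φ (U ω))).prod (P.map V) := by
  have hφU : Measurable fun ω => φ (U ω) := hφ.comp hU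
  symm
  refine Measure.prod_eq fun s t hs ht => ?_
  rw [Measure.map_apply (hφU.prodMk hV) (hs.prod ht),
    Measure.map_apply hφU hs, Measure.map_apply hV ht,
    Measure.restrict_apply ((hφU.prodMk hV) (hs.prod ht)),
    Measure.restrict_apply (hφU hs)]
  have h1 := h.measure_inter_preimage_eq_mul (φ ⁻¹' s ∩ A) t ((hφ hs).inter hA) ht
  refine Eq.trans (congrArg P ?_) h1
  ext ω
  simp only [mem_inter_iff, mem_preimage, mem_prod]
  tauto

end Mixture

/-! ### Pathwise identities for the default times. -/

section Deterministic

variable {Ω : Type*} {X : ℝ≥0 → Ω → ℝ} {N : ℝ≥0} {D x : ℝ} {ω : Ω}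

theorem recordedDefault_eq_of_first {k : ℕ} (hk : 1 ≤ k) (h : firmValue X x (k * N) ω ≤ D)
    (hlt : ∀ j : ℕ, 1 ≤ j → j < k → D < firmValue X x (j * N) ω) :
    recordedDefault X N D x ω = ((k * N : ℝ≥0) : ℝ≥0∞) := by
  refine le_antisymm (sInf_le ⟨k, hk, rfl, h⟩) (le_sInf ?_)
  rintro _ ⟨j, hj, rfl, hle⟩
  have hkj : k ≤ j := by
    by_contra hcon
    exact absurd hle (not_le.2 (hlt j hj (by omega)))
  exact ENNReal.coe_le_coe.2 (by gcongr)

theorem recordedDefault_cases (X : ℝ≥0 → Ω → ℝ) (N : ℝ≥0) (D x : ℝ) (ω : Ω) :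
    (recordedDefault X N D x ω = ∞ ∧ ∀ j : ℕ, 1 ≤ j → D < firmValue X x (j * N) ω) ∨
      ∃ k : ℕ, recordedDefault X N D x ω = (((k + 1 : ℕ) * N : ℝ≥0) : ℝ≥0∞) ∧
        firmValue X x ((k + 1 : ℕ) * N) ω ≤ D ∧
        ∀ j : ℕ, 1 ≤ j → j ≤ k → D < firmValue X x (j * N) ω := by
  classical
  by_cases h : ∃ k : ℕ, 1 ≤ k ∧ firmValue X x (k * N) ω ≤ D
  · right
    obtain ⟨h1, h2⟩ := Nat.find_spec h
    have h3 : ∀ j : ℕ, 1 ≤ j → j < Nat.find h → D < firmValue X x (j * N) ω := fun j hj hlt =>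
      not_le.1 fun hle => Nat.find_min h hlt ⟨hj, hle⟩
    obtain ⟨k, hk⟩ := Nat.exists_eq_add_of_le' h1
    rw [hk] at h2 h3
    exact ⟨k, recordedDefault_eq_of_first (by omega) h2 h3, h2, fun j hj hle =>
      h3 j hj (by omega)⟩
  · left
    push Not at h
    refine ⟨sInf_eq_top.2 ?_, h⟩
    rintro _ ⟨k, hk, rfl, hle⟩
    exact absurd hle (not_le.2 (h k hk))

theorem mem_defaultAt_succ_iff (hN : 0 < N) {k : ℕ} :
    ω ∈ defaultAt X N D x (k + 1) ↔ firmValue X x ((k + 1 : ℕ) * N) ω ≤ D ∧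
      ∀ j : ℕ, 1 ≤ j → j ≤ k → D < firmValue X x (j * N) ω := by
  constructor
  · intro h
    change recordedDefault X N D x ω = (((k + 1 : ℕ) * N : ℝ≥0) : ℝ≥0∞) at h
    rcases recordedDefault_cases X N D x ω with ⟨htop, -⟩ | ⟨j, hj, h1, h2⟩
    · exact absurd (h.symm.trans htop) ENNReal.coe_ne_top
    · have := mul_right_cancel₀ hN.ne' (ENNReal.coe_injective (h.symm.trans hj))
      have hkj : k = j := by
        have : k + 1 = j + 1 := by exact_mod_cast this
        omega
      subst hkj
      exact ⟨h1, h2⟩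
  · rintro ⟨h1, h2⟩
    exact recordedDefault_eq_of_first (by omega) h1 fun j hj hlt => h2 j hj (by omega)

theorem firmValue_add (c t : ℝ≥0) :
    firmValue X x (c + t) ω = firmValue X x c ω * Real.exp (X (c + t) ω - X c ω) := by
  rw [firmValue, firmValue, mul_assoc, ← Real.exp_add]
  ring_nf

theorem le_mul_exp_iff {u y : ℝ} (hD : 0 < D) (hu : 0 < u) :
    D ≤ u * Real.exp y ↔ Real.log (D / u) ≤ y := by
  rw [← div_le_iff₀' hu, Real.log_le_iff_le_exp (div_pos hD hu)]

theorem mul_exp_le_iff {u y : ℝ} (hD : 0 < D) (hu : 0 < u) :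
    u * Real.exp y ≤ D ↔ y ≤ Real.log (D / u) := by
  rw [← le_div_iff₀' hu, Real.le_log_iff_exp_le (div_pos hD hu)]

theorem firmValue_pos (hx : 0 < x) (t : ℝ≥0) : 0 < firmValue X x t ω :=
  mul_pos hx (Real.exp_pos _)

/-- The delay between economic and recorded default as the age of the shifted path. -/
theorem recordedDefault_sub_economicDefault (hD : 0 < D) (hx : 0 < x) {k : ℕ}
    (hω : ω ∈ defaultAt X N D x (k + 1))
    (hk : D ≤ firmValue X x (k * N) ω)
    (hev : ∀ t, evalPath (shiftedPath X (k * N) ω) t = X (k * N + t) ω - X (k * N) ω) :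
    recordedDefault X N D x ω - economicDefault X N D x ω =
      pathAge (shiftedPath X (k * N) ω) (Real.log (D / firmValue X x (k * N) ω)) N := by
  have hr : recordedDefault X N D x ω = ((k * N + N : ℝ≥0) : ℝ≥0∞) := by
    have : recordedDefault X N D x ω = (((k + 1 : ℕ) * N : ℝ≥0) : ℝ≥0∞) := hω
    rw [this]
    push_cast
    ring
  have hrN : recordedDefault X N D x ω - N = ((k * N : ℝ≥0) : ℝ≥0∞) := by
    rw [hr, ← ENNReal.coe_sub, add_tsub_cancel_right]
  have hlev : ∀ t, Real.log (D / firmValue X x (k * N) ω) ≤ evalPath (shiftedPath X (k * N) ω) t ↔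
      D ≤ firmValue X x (k * N + t) ω := fun t => by
    rw [hev, firmValue_add, le_mul_exp_iff hD (firmValue_pos hx _)]
  have hne : recordedDefault X N D x ω ≠ ∞ := by rw [hr]; exact ENNReal.coe_ne_top
  rw [economicDefault, if_neg hne, hrN, hr]
  set c : ℝ≥0 := k * N with hc
  refine le_antisymm (le_sInf ?_) ?_
  · rintro _ ⟨s, rfl, hs, hle⟩
    have hmem : ((c + (N - s) : ℝ≥0) : ℝ≥0∞) ≤
        sSup {t | ∃ s : ℝ≥0, t = (s : ℝ≥0∞) ∧ (c : ℝ≥0∞) ≤ s ∧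
          (s : ℝ≥0∞) ≤ ((c + N : ℝ≥0) : ℝ≥0∞) ∧ D ≤ firmValue X x s ω} := by
      refine le_sSup ⟨c + (N - s), rfl, ?_, ?_, (hlev _).1 hle⟩
      · exact ENNReal.coe_le_coe.2 (le_add_of_nonneg_right zero_le)
      · exact ENNReal.coe_le_coe.2 (by gcongr; exact tsub_le_self)
    refine (tsub_le_tsub_left hmem _).trans ?_
    rw [← ENNReal.coe_sub, ENNReal.coe_le_coe, add_tsub_add_eq_tsub_left, tsub_tsub_cancel_of_le hs]
  · set b := pathAge (shiftedPath X c ω) (Real.log (D / firmValue X x c ω)) N with hb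
    -- An admissible time `s` for the supremum corresponds to the age `c + N - s`.
    have hbs : ∀ s : ℝ≥0, c ≤ s → s ≤ c + N → D ≤ firmValue X x s ω →
        b ≤ ((c + N - s : ℝ≥0) : ℝ≥0∞) := by
      intro s h1 h2 h3
      refine sInf_le ⟨c + N - s, rfl, ?_, ?_⟩
      · rw [tsub_le_iff_right, add_comm]
        gcongr
      · rw [hlev]
        convert h3 using 2
        rw [tsub_tsub_eq_add_tsub_of_le h2]
        rw [← add_tsub_assoc_of_le (by rw [add_comm N s]; gcongr), ← add_assoc, add_comm c N]
        exact add_tsub_cancel_left _ _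
    -- The hypothesis `hk` makes `c` itself admissible, so the age is finite and the truncated
    -- subtractions can be inverted.
    have hbr : b ≤ ((c + N : ℝ≥0) : ℝ≥0∞) :=
      (hbs c le_rfl (le_add_of_nonneg_right zero_le) hk).trans
        (ENNReal.coe_le_coe.2 tsub_le_self)
    have hbt : b ≠ ∞ := ne_top_of_le_ne_top ENNReal.coe_ne_top hbr
    have hle : sSup {t | ∃ s : ℝ≥0, t = (s : ℝ≥0∞) ∧ (c : ℝ≥0∞) ≤ s ∧
        (s : ℝ≥0∞) ≤ ((c + N : ℝ≥0) : ℝ≥0∞) ∧ D ≤ firmValue X x s ω} ≤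
        ((c + N : ℝ≥0) : ℝ≥0∞) - b := by
      refine sSup_le ?_
      rintro _ ⟨s, rfl, h1, h2, h3⟩
      rw [ENNReal.coe_le_coe] at h1 h2
      refine ENNReal.le_sub_of_add_le_left hbt ?_
      calc b + s ≤ ((c + N - s : ℝ≥0) : ℝ≥0∞) + s := by gcongr; exact hbs s h1 h2 h3
        _ = ((c + N : ℝ≥0) : ℝ≥0∞) := by rw [← ENNReal.coe_add, tsub_add_cancel_of_le h2]
    refine ENNReal.le_sub_of_add_le_left
      (ne_top_of_le_ne_top ENNReal.coe_ne_top (hle.trans tsub_le_self)) ?_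
    calc _ ≤ ((c + N : ℝ≥0) : ℝ≥0∞) - b + b := by gcongr
      _ = _ := tsub_add_cancel_of_le hbr

end Deterministic

/-! ### The law of the delay as a mixture. -/

section DelayLaw

variable {Ω : Type*} {X : ℝ≥0 → Ω → ℝ} {N : ℝ≥0} {D x : ℝ}

theorem defaultAt_succ_eq (hN : 0 < N) (k : ℕ) :
    defaultAt X N D x (k + 1) =
      {ω | ∀ j : ℕ, 1 ≤ j → j ≤ k → D < firmValue X x (j * N) ω} ∩
        {ω | firmValue X x ((k + 1 : ℕ) * N) ω ≤ D} := by
  ext ω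
  rw [mem_defaultAt_succ_iff hN, and_comm]
  rfl

/-- A right-continuous path without downward jumps hits a level when it first passes below it. -/
theorem eq_level_at_first_passage {f : ℝ≥0 → ℝ} {a : ℝ} (h0 : a ≤ f 0)
    (hr : ∀ t, ContinuousWithinAt f (Ioi t) t) (hl : ∀ t, ∃ l, Tendsto f (𝓝[<] t) (𝓝 l))
    (hj : ∀ t, 0 < t → ∀ l, Tendsto f (𝓝[<] t) (𝓝 l) → l ≤ f t)
    (hfin : sInf {t : ℝ≥0∞ | ∃ s : ℝ≥0, t = s ∧ f s ≤ a} ≠ ∞) :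
    f (sInf {t : ℝ≥0∞ | ∃ s : ℝ≥0, t = s ∧ f s ≤ a}).toNNReal = a := by
  set H := sInf {t : ℝ≥0∞ | ∃ s : ℝ≥0, t = s ∧ f s ≤ a} with hH
  set h := H.toNNReal with hh
  have hHh : H = h := (ENNReal.coe_toNNReal hfin).symm
  have hbefore : ∀ s < h, a < f s := by
    intro s hs
    by_contra! hle
    have : H ≤ s := sInf_le ⟨s, rfl, hle⟩
    rw [hHh, ENNReal.coe_le_coe] at this
    exact absurd hs (not_lt.2 this)
  refine le_antisymm ?_ ?_
  · by_contra! hlt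
    -- If `f h` exceeded `a`, right-continuity would keep `f` above `a` a little longer, against the
    -- definition of the infimum.
    have hev : ∀ᶠ s in 𝓝[>] h, a < f s := (hr h).tendsto.eventually (Ioi_mem_nhds hlt)
    obtain ⟨b, hb, hbs⟩ := mem_nhdsGT_iff_exists_Ioo_subset.1 hev
    have : H < b := by rw [hHh]; exact ENNReal.coe_lt_coe.2 hb
    obtain ⟨_, ⟨s, rfl, hs⟩, hsb⟩ := sInf_lt_iff.1 this
    rw [ENNReal.coe_lt_coe] at hsb
    rcases lt_trichotomy s h with hsh | rfl | hsh
    · exact absurd hs (not_le.2 (hbefore s hsh))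
    · exact absurd hs (not_le.2 hlt)
    · exact absurd hs (not_le.2 (hbs ⟨hsh, hsb⟩))
  · rcases eq_zero_or_pos h with h00 | hpos
    · rw [h00]; exact h0
    · obtain ⟨l, hlim⟩ := hl h
      have : (𝓝[<] h).NeBot := nhdsLT_neBot_of_exists_lt ⟨0, hpos⟩
      -- The left limit is at least `a`, and the value at `h` cannot jump below it.
      have hal : a ≤ l := ge_of_tendsto hlim (by
        filter_upwards [self_mem_nhdsWithin] with s hs
        exact (hbefore s hs).le)
      exact hal.trans (hj h hpos l hlim)

/-- Since `r'` qualifies, later times do not affect the infimum. This lets an age computed back from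
`N` stop at the first passage. -/
theorem sInf_times_eq_of_mem {p : ℝ≥0 → Prop} {r r' : ℝ≥0} (hrr : r' ≤ r) (hp : p r') :
    sInf {t : ℝ≥0∞ | ∃ s : ℝ≥0, t = s ∧ s ≤ r ∧ p s} =
      sInf {t : ℝ≥0∞ | ∃ s : ℝ≥0, t = s ∧ s ≤ r' ∧ p s} := by
  refine le_antisymm (sInf_le_sInf ?_) (le_sInf ?_)
  · rintro _ ⟨s, rfl, hs, hps⟩
    exact ⟨s, rfl, hs.trans hrr, hps⟩
  · rintro _ ⟨s, rfl, hs, hps⟩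
    rcases le_total s r' with h | h
    · exact sInf_le ⟨s, rfl, h, hps⟩
    · exact le_trans (b := (r' : ℝ≥0∞)) (sInf_le ⟨r', rfl, le_rfl, hp⟩) (ENNReal.coe_le_coe.2 h)

theorem mem_defaultAt_one_iff (hN : 0 < N) (hD : 0 < D) (hx : 0 < x) {ω : Ω} :
    ω ∈ defaultAt X N D x 1 ↔ X N ω ≤ Real.log (D / x) := by
  have := mem_defaultAt_succ_iff (X := X) (D := D) (x := x) (ω := ω) hN (k := 0)
  simp only [zero_add, Nat.cast_one, one_mul, firmValue] at this
  rw [this, mul_exp_le_iff hD hx]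
  exact and_iff_left fun j h1 h2 => by omega

variable [MeasurableSpace Ω] {P : Measure Ω}

theorem ae_cond_of_ae_imp {p : Ω → Prop} {s : Set Ω} (hs : MeasurableSet s)
    (h : ∀ᵐ ω ∂P, ω ∈ s → p ω) : ∀ᵐ ω ∂P[|s], p ω :=
  Measure.smul_absolutelyContinuous.ae_le ((ae_restrict_iff' hs).2 h)

theorem IsLevyProcess.cond_pathLaw_apply (hX : IsLevyProcess X P) {S E : Set GridPath}
    (hS : MeasurableSet S) (hE : NullMeasurableSet E (pathLaw X P)) :
    (pathLaw X P)[|S] E = P[|observe X ⁻¹' S] (observe X ⁻¹' E) := by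
  have hO := hX.measurable_observe
  rw [cond_apply hS, cond_apply (hO hS), pathLaw, Measure.map_apply hO hS,
    Measure.map_apply₀ hO.aemeasurable (hS.nullMeasurableSet.inter hE)]
  rfl

theorem cond_congr_set {s t : Set Ω} (h : s =ᵐ[P] t) : P[|s] = P[|t] := by
  rw [ProbabilityTheory.cond, ProbabilityTheory.cond, measure_congr h, Measure.restrict_congr_set h]

theorem IsLevyProcess.measurable_firmValue (hX : IsLevyProcess X P) (x : ℝ) (t : ℝ≥0) :
    Measurable (firmValue X x t) :=
  ((hX.measurable t).exp).const_mul x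

theorem IsLevyProcess.measurableSet_survival (hX : IsLevyProcess X P) (N : ℝ≥0) (D x : ℝ)
    (k : ℕ) : MeasurableSet {ω | ∀ j : ℕ, 1 ≤ j → j ≤ k → D < firmValue X x (j * N) ω} := by
  simp only [Set.ofPred_forall]
  exact MeasurableSet.iInter fun j => MeasurableSet.iInter fun _ => MeasurableSet.iInter fun _ =>
    measurableSet_lt measurable_const (hX.measurable_firmValue x _)

theorem IsLevyProcess.measurableSet_defaultAt (hX : IsLevyProcess X P) (hN : 0 < N) (k : ℕ) :
    MeasurableSet (defaultAt X N D x (k + 1)) := by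
  rw [defaultAt_succ_eq hN]
  exact (hX.measurableSet_survival N D x k).inter
    (measurableSet_le (hX.measurable_firmValue x _) measurable_const)

/-- Survival gives this for `k ≥ 1`. Time `0` is not an inspection, so `k = 0` rests on `D ≤ x` and
`X 0 = 0`. -/
theorem IsLevyProcess.ae_le_firmValue (hX : IsLevyProcess X P) (hN : 0 < N) (hx : D ≤ x) (k : ℕ) :
    ∀ᵐ ω ∂P, ω ∈ defaultAt X N D x (k + 1) → D ≤ firmValue X x (k * N) ω := by
  filter_upwards [hX.start] with ω h0 hω
  rcases Nat.eq_zero_or_pos k with rfl | hk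
  · simpa [firmValue, h0] using hx
  · exact (((mem_defaultAt_succ_iff hN).1 hω).2 k hk le_rfl).le

/-- The delay between the economic and the recorded default, as a functional of the path after
the last inspection before default. -/
def delayAge (X : ℝ≥0 → Ω → ℝ) (N : ℝ≥0) (D x : ℝ) (k : ℕ) (ω : Ω) : ℝ≥0∞ :=
  pathAge (shiftedPath X (k * N) ω) (Real.log (D / firmValue X x (k * N) ω)) N

theorem IsLevyProcess.ae_delay_eq (hX : IsLevyProcess X P) (hN : 0 < N) (hD : 0 < D) (hx : D ≤ x)
    (k : ℕ) : ∀ᵐ ω ∂P, ω ∈ defaultAt X N D x (k + 1) →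
      recordedDefault X N D x ω - economicDefault X N D x ω = delayAge X N D x k ω := by
  filter_upwards [hX.ae_le_firmValue hN hx k, hX.ae_evalPath_shiftedPath] with ω h1 h2 hω
  exact recordedDefault_sub_economicDefault hD (hD.trans_le hx) hω (h1 hω) (h2 _)

theorem IsLevyProcess.ae_eq_level_pathHit (hX : IsLevyProcess X P)
    (hpos : IsSpectrallyPositive X P) {a : ℝ} (ha : a ≤ 0) :
    ∀ᵐ ω ∂P, pathHit (observe X ω) a ≠ ∞ → X (pathHit (observe X ω) a).toNNReal ω = a := by
  filter_upwards [hX.ae_evalPath_observe, hX.start, hX.cadlag, hpos] with ω h1 h3 h4 h5 hfin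
  have hHeq : pathHit (observe X ω) a = sInf {t : ℝ≥0∞ | ∃ s : ℝ≥0, t = s ∧ X s ω ≤ a} := by
    simp only [pathHit, h1]
  rw [hHeq] at hfin ⊢
  exact eq_level_at_first_passage (f := fun t => X t ω) (by simpa [h3] using ha)
    (fun t => (h4 t).1) (fun t => (h4 t).2) h5 hfin

variable [IsProbabilityMeasure P]

theorem IsLevyProcess.aemeasurable_delayAge (hX : IsLevyProcess X P) (N : ℝ≥0) (D x : ℝ) (k : ℕ) :
    AEMeasurable (delayAge X N D x k) P :=
  aemeasurable_pathAge_comp (hX.measurable_shiftedPath _).aemeasurable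
    (((hX.measurable_firmValue x _).const_div D).log).aemeasurable aemeasurable_const

theorem IsLevyProcess.delayLaw_apply (hX : IsLevyProcess X P) (hN : 0 < N) (hD : 0 < D)
    (hx : D ≤ x) (k : ℕ) {B : Set ℝ≥0∞} (hB : MeasurableSet B) :
    delayLaw X P N D x (k + 1) B =
      P[|defaultAt X N D x (k + 1)] (delayAge X N D x k ⁻¹' B) := by
  have hm := hX.measurableSet_defaultAt (D := D) (x := x) hN k
  rw [delayLaw, Measure.map_congr (ae_cond_of_ae_imp hm (hX.ae_delay_eq hN hD hx k)),
    Measure.map_apply_of_aemeasurable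
      ((hX.aemeasurable_delayAge N D x k).mono_ac cond_absolutelyContinuous) hB]

theorem nullMeasurableSet_pathAge_comp {α : Type*} [MeasurableSpace α] {μ : Measure α}
    [IsFiniteMeasure μ] {Y : α → GridPath} {d : α → ℝ} {r : α → ℝ≥0} (hY : Measurable Y)
    (hd : Measurable d) (hr : Measurable r) {B : Set ℝ≥0∞} (hB : MeasurableSet B) :
    NullMeasurableSet {a | pathAge (Y a) (d a) (r a) ∈ B} μ :=
  (aemeasurable_pathAge_comp hY.aemeasurable hd.aemeasurable hr.aemeasurable).nullMeasurable hB

/-- The law of the delay given default at the first inspection, through the law of the path. -/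
theorem IsLevyProcess.delayLaw_one_apply (hX : IsLevyProcess X P) (hN : 0 < N) (hD : 0 < D)
    {u : ℝ} (hu : D ≤ u) {B : Set ℝ≥0∞} (hB : MeasurableSet B) :
    delayLaw X P N D u 1 B = (pathLaw X P)[|{y | evalPath y N ≤ Real.log (D / u)}]
      {y | pathAge y (Real.log (D / u)) N ∈ B} := by
  have hL := hX.isProbabilityMeasure_pathLaw
  have hu0 : 0 < u := hD.trans_le hu
  rw [hX.cond_pathLaw_apply
    (measurableSet_le (measurable_evalPath_comp measurable_id' measurable_const) measurable_const)
    (nullMeasurableSet_pathAge_comp measurable_id' measurable_const measurable_const hB)]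
  have h1 : delayLaw X P N D u 1 B = _ := hX.delayLaw_apply hN hD hu 0 hB
  have hset : defaultAt X N D u (0 + 1) =ᵐ[P]
      observe X ⁻¹' {y | evalPath y N ≤ Real.log (D / u)} := by
    filter_upwards [hX.ae_evalPath_observe] with ω hω
    refine propext ?_
    change ω ∈ defaultAt X N D u (0 + 1) ↔ evalPath (observe X ω) N ≤ Real.log (D / u)
    rw [mem_defaultAt_succ_iff hN, hω, ← mul_exp_le_iff hD hu0]
    simp only [zero_add, Nat.cast_one, one_mul, firmValue]
    exact and_iff_left fun j h1 h2 => by omega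
  rw [h1, cond_congr_set hset]
  refine measure_congr (cond_absolutelyContinuous.ae_eq ?_)
  filter_upwards [hX.start] with ω hω
  refine propext ?_
  change delayAge X N D u 0 ω ∈ B ↔ pathAge (observe X ω) (Real.log (D / u)) N ∈ B
  have hpath : shiftedPath X 0 ω = observe X ω := by
    ext p
    simp [shiftedPath, incrementAfter, observe, hω]
  simp [delayAge, hpath, firmValue, hω]

theorem IsLevyProcess.negativeAgeLaw_apply (hX : IsLevyProcess X P) (r : ℝ≥0)
    {B : Set ℝ≥0∞} (hB : MeasurableSet B) :
    negativeAgeLaw X P r B = (pathLaw X P)[|{y | evalPath y r ≤ 0}] {y | pathAge y 0 r ∈ B} := by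
  have hL := hX.isProbabilityMeasure_pathLaw
  rw [hX.cond_pathLaw_apply
    (measurableSet_le (measurable_evalPath_comp measurable_id' measurable_const) measurable_const)
    (nullMeasurableSet_pathAge_comp measurable_id' measurable_const measurable_const hB)]
  have hset : {ω | X r ω ≤ 0} =ᵐ[P] observe X ⁻¹' {y | evalPath y r ≤ 0} := by
    filter_upwards [hX.ae_evalPath_observe] with ω hω
    refine propext ?_
    change X r ω ≤ 0 ↔ evalPath (observe X ω) r ≤ 0
    rw [hω]
  have hage : negativeAge X r =ᵐ[P] fun ω => pathAge (observe X ω) 0 r := by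
    filter_upwards [hX.ae_evalPath_observe] with ω hω
    simp only [negativeAge, pathAge, hω]
  have hm : AEMeasurable (fun ω => pathAge (observe X ω) 0 r) P :=
    aemeasurable_pathAge_comp hX.measurable_observe.aemeasurable aemeasurable_const
      aemeasurable_const
  rw [negativeAgeLaw, Measure.map_congr (cond_absolutelyContinuous.ae_eq hage),
    Measure.map_apply_of_aemeasurable (hm.mono_ac cond_absolutelyContinuous) hB,
    cond_congr_set hset]
  rfl

/-- Given default at the `(k+1)`-st inspection, the delay has the law of a mixture. -/
theorem IsLevyProcess.delayLaw_succ_eq_lintegral (hX : IsLevyProcess X P) (hN : 0 < N) (hD : 0 < D)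
    (hx : D ≤ x) (k : ℕ) {B : Set ℝ≥0∞} (hB : MeasurableSet B) :
    delayLaw X P N D x (k + 1) B =
      ∫⁻ u in Ici D, delayLaw X P N D u 1 B
        ∂((P[|defaultAt X N D x (k + 1)]).map (firmValue X x (k * N))) := by
  have hL := hX.isProbabilityMeasure_pathLaw
  have hx0 : 0 < x := hD.trans_le hx
  have hm := hX.measurableSet_defaultAt (D := D) (x := x) hN k
  set c : ℝ≥0 := k * N with hc
  set A : Set Ω := {ω | ∀ j : ℕ, 1 ≤ j → j ≤ k → D < firmValue X x (j * N) ω} with hA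
  let S : Set (ℝ × GridPath) := {p | evalPath p.2 N ≤ Real.log (D / p.1)}
  let E : Set (ℝ × GridPath) := {p | pathAge p.2 (Real.log (D / p.1)) N ∈ B}
  have hS : MeasurableSet S := measurableSet_le
    (measurable_evalPath_comp measurable_snd measurable_const) (measurable_fst.const_div D).log
  -- Survival and the value at `c` belong to the past of `c`, so restricting to survival keeps the
  -- product structure.
  have hprod : (P.restrict A).map (fun ω => (firmValue X x c ω, shiftedPath X c ω)) =
      ((P.restrict A).map (firmValue X x c)).prod (pathLaw X P) := by
    have hjc : ∀ j : ℕ, j ≤ k → (j : ℝ≥0) * N ≤ c := fun j hj => by rw [hc]; gcongr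
    let A' : Set (Iic c → ℝ) := {f | ∀ (j : ℕ) (_ : 1 ≤ j) (h : j ≤ k),
      D < x * Real.exp (f ⟨j * N, hjc j h⟩)}
    have hA' : MeasurableSet A' := by
      simp only [A', Set.ofPred_forall]
      exact MeasurableSet.iInter fun j => MeasurableSet.iInter fun _ => MeasurableSet.iInter
        fun h => measurableSet_lt measurable_const ((measurable_pi_apply _).exp.const_mul x)
    have h := map_restrict_prodMk_of_indepFun (hX.indepFun_shiftedPath c)
      (measurable_pi_lambda _ fun s => hX.measurable s) (hX.measurable_shiftedPath c)
      (φ := fun f : Iic c → ℝ => x * Real.exp (f ⟨c, mem_Iic.2 le_rfl⟩))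
      ((measurable_pi_apply (⟨c, mem_Iic.2 le_rfl⟩ : Iic c)).exp.const_mul x) hA'
    rw [hX.map_shiftedPath] at h
    exact h
  have hdef : defaultAt X N D x (k + 1) =ᵐ[P]
      (A ∩ (fun ω => (firmValue X x c ω, shiftedPath X c ω)) ⁻¹' S : Set Ω) := by
    rw [defaultAt_succ_eq hN]
    refine (ae_eq_refl A).inter ?_
    filter_upwards [hX.ae_evalPath_shiftedPath] with ω hω
    refine propext ?_
    change firmValue X x ((k + 1 : ℕ) * N) ω ≤ D ↔
      evalPath (shiftedPath X c ω) N ≤ Real.log (D / firmValue X x c ω)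
    rw [hω, ← mul_exp_le_iff hD (firmValue_pos hx0 _), ← firmValue_add]
    have : ((k + 1 : ℕ) : ℝ≥0) * N = c + N := by rw [hc]; push_cast; ring
    rw [this]
  have hE : NullMeasurableSet E (((P.restrict A).map (firmValue X x c)).prod (pathLaw X P)) :=
    nullMeasurableSet_pathAge_comp measurable_snd (measurable_fst.const_div D).log
      measurable_const hB
  have hW := hX.measurable_firmValue x c |>.prodMk (hX.measurable_shiftedPath c)
  have hres : P.restrict (defaultAt X N D x (k + 1)) =
      (P.restrict A).restrict ((fun ω => (firmValue X x c ω, shiftedPath X c ω)) ⁻¹' S) := by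
    rw [Measure.restrict_restrict (hW hS), inter_comm, Measure.restrict_congr_set hdef]
  have key := restrict_apply_eq_lintegral_cond (hX.measurable_firmValue x c).aemeasurable
    (hX.measurable_shiftedPath c).aemeasurable hprod hS hE
  rw [← hres] at key
  -- The section laws are identified with delay laws only for `u ≥ D`, and the mixing law lives
  -- there.
  have hconc : ∀ᵐ u ∂((P[|defaultAt X N D x (k + 1)]).map (firmValue X x c)), u ∈ Ici D :=
    (ae_map_iff (hX.measurable_firmValue x c).aemeasurable measurableSet_Ici).2
      (ae_cond_of_ae_imp hm (hX.ae_le_firmValue hN hx k))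
  rw [hX.delayLaw_apply hN hD hx k hB, setLIntegral_congr_fun measurableSet_Ici
    (g := fun u => (pathLaw X P)[|Prod.mk u ⁻¹' S] (Prod.mk u ⁻¹' E))
    (fun u hu => hX.delayLaw_one_apply hN hD hu hB),
    Measure.restrict_eq_self_of_ae_mem hconc, ProbabilityTheory.cond, Measure.map_smul, lintegral_smul_measure, ← key]
  rfl

/-- The shifted path at a first passage time. -/
def passagePath (X : ℝ≥0 → Ω → ℝ) (a : ℝ) (ω : Ω) : GridPath :=
  shiftedPath X (pathHit (observe X ω) a).toNNReal ω

theorem IsLevyProcess.aemeasurable_passagePath (hX : IsLevyProcess X P) (a : ℝ) :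
    AEMeasurable (passagePath X a) P :=
  hX.aemeasurable_shiftedPath_random (hX.aemeasurable_pathHit_observe a).ennreal_toNNReal

/-- Up to a finite time, the first passage time and the path after it are independent, and the
latter has the law of the process. -/
theorem IsLevyProcess.map_pathHit_passagePath (hX : IsLevyProcess X P) (a : ℝ) (N : ℝ≥0) :
    (P.restrict ((fun ω => pathHit (observe X ω) a) ⁻¹' Iic (N : ℝ≥0∞))).map
        (fun ω => (pathHit (observe X ω) a, passagePath X a ω)) =
      ((P.restrict ((fun ω => pathHit (observe X ω) a) ⁻¹' Iic (N : ℝ≥0∞))).map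
        (fun ω => pathHit (observe X ω) a)).prod (pathLaw X P) := by
  have hL := hX.isProbabilityMeasure_pathLaw
  have hH := hX.aemeasurable_pathHit_observe a
  have hZ := hX.aemeasurable_passagePath a
  symm
  refine Measure.prod_eq fun C F hC hF => ?_
  have hC' : MeasurableSet (C ∩ Iic (N : ℝ≥0∞)) := hC.inter measurableSet_Iic
  have h1 := congrArg (fun μ => μ F)
    -- Intersecting with `Iic N` removes the infinite passage time.
    (hX.map_shiftedPath_pathHit a hC' (fun h => absurd h.2 (by simp)))
  simp only [Measure.smul_apply, smul_eq_mul] at h1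
  change (Measure.map (passagePath X a) _) F = _ at h1
  rw [Measure.map_apply_of_aemeasurable hZ.restrict hF,
    Measure.restrict_apply₀ (hZ.restrict.nullMeasurable hF)] at h1
  rw [Measure.map_apply_of_aemeasurable (hH.prodMk hZ).restrict (hC.prod hF),
    Measure.map_apply_of_aemeasurable hH.restrict hC,
    Measure.restrict_apply₀ ((hH.prodMk hZ).restrict.nullMeasurable (hC.prod hF)),
    Measure.restrict_apply₀ (hH.restrict.nullMeasurable hC)]
  refine Eq.trans (congrArg P ?_) h1
  ext ω
  simp only [mem_inter_iff, mem_preimage, mem_prod]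
  tauto

/-- In the spectrally positive case, the delay given default at the first inspection is a mixture
of ages, by the strong Markov property at the first passage. -/
theorem IsLevyProcess.delayLaw_one_eq_lintegral (hX : IsLevyProcess X P)
    (hpos : IsSpectrallyPositive X P) (hN : 0 < N) (hD : 0 < D) {u : ℝ} (hu : D ≤ u)
    {B : Set ℝ≥0∞} (hB : MeasurableSet B) :
    delayLaw X P N D u 1 B =
      ∫⁻ v in Iic (N : ℝ≥0∞), negativeAgeLaw X P (N - v.toNNReal) B
        ∂((P[|defaultAt X N D u 1]).map (firstPassage X D u)) := by
  have hL := hX.isProbabilityMeasure_pathLaw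
  have hu0 : 0 < u := hD.trans_le hu
  have hm : MeasurableSet (defaultAt X N D u 1) := hX.measurableSet_defaultAt hN 0
  set a : ℝ := Real.log (D / u) with ha
  have ha0 : a ≤ 0 := Real.log_nonpos (div_pos hD hu0).le ((div_le_one hu0).2 hu)
  set H : Ω → ℝ≥0∞ := fun ω => pathHit (observe X ω) a with hHdef
  set Z : Ω → GridPath := passagePath X a with hZdef
  have hH : AEMeasurable H P := hX.aemeasurable_pathHit_observe a
  have hZ : AEMeasurable Z P := hX.aemeasurable_passagePath a
  set A : Set Ω := H ⁻¹' Iic (N : ℝ≥0∞) with hA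
  let S : Set (ℝ≥0∞ × GridPath) := {p | evalPath p.2 (N - p.1.toNNReal) ≤ 0}
  let E : Set (ℝ≥0∞ × GridPath) := {p | pathAge p.2 0 (N - p.1.toNNReal) ∈ B}
  have htime : Measurable fun p : ℝ≥0∞ × GridPath => N - p.1.toNNReal :=
    measurable_const.sub measurable_fst.ennreal_toNNReal
  have hS : MeasurableSet S := measurableSet_le
    (measurable_evalPath_comp measurable_snd htime) measurable_const
  have hprod := hX.map_pathHit_passagePath a N
  have hgood : ∀ᵐ ω ∂P, (∀ t, evalPath (observe X ω) t = X t ω) ∧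
      (∀ c t, evalPath (shiftedPath X c ω) t = X (c + t) ω - X c ω) ∧
      (H ω ≠ ∞ → X (H ω).toNNReal ω = a) := by
    filter_upwards [hX.ae_evalPath_observe, hX.ae_evalPath_shiftedPath,
      hX.ae_eq_level_pathHit hpos ha0] with ω h1 h2 h3
    exact ⟨h1, h2, h3⟩
  have hmem : ∀ ω, ω ∈ defaultAt X N D u 1 ↔ X N ω ≤ a := fun ω =>
    mem_defaultAt_one_iff hN hD hu0
  have hle : ∀ᵐ ω ∂P, ω ∈ defaultAt X N D u 1 → H ω ≤ N := by
    filter_upwards [hgood] with ω hω hd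
    refine sInf_le ⟨N, rfl, ?_⟩
    rw [hω.1]
    exact (hmem ω).1 hd
  have hsplit : ∀ ω, H ω ≤ N → (H ω).toNNReal ≤ N ∧
      (H ω).toNNReal + (N - (H ω).toNNReal) = N := by
    intro ω h
    have : (H ω).toNNReal ≤ N := by
      simpa using ENNReal.toNNReal_mono ENNReal.coe_ne_top h
    exact ⟨this, add_tsub_cancel_of_le this⟩
  have hdef : defaultAt X N D u 1 =ᵐ[P] (A ∩ (fun ω => (H ω, Z ω)) ⁻¹' S : Set Ω) := by
    filter_upwards [hgood, hle] with ω hω hω'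
    refine propext ?_
    change ω ∈ defaultAt X N D u 1 ↔
      H ω ≤ N ∧ evalPath (Z ω) (N - (H ω).toNNReal) ≤ 0
    -- The path starts afresh from exactly `a`, so being at most `a` at `N` means that the fresh
    -- path is nonpositive at `N - H`.
    have key : H ω ≤ N → (evalPath (Z ω) (N - (H ω).toNNReal) ≤ 0 ↔ X N ω ≤ a) := by
      intro h
      rw [hZdef, passagePath, hω.2.1, (hsplit ω h).2,
        hω.2.2 (ne_top_of_le_ne_top ENNReal.coe_ne_top h), sub_nonpos]
    constructor
    · intro hd
      exact ⟨hω' hd, (key (hω' hd)).2 ((hmem ω).1 hd)⟩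
    · rintro ⟨h1, h2⟩
      exact (hmem ω).2 ((key h1).1 h2)
  have hE : NullMeasurableSet E (((P.restrict A).map H).prod (pathLaw X P)) :=
    nullMeasurableSet_pathAge_comp measurable_snd measurable_const htime hB
  have hres : P.restrict (defaultAt X N D u 1) =
      (P.restrict A).restrict ((fun ω => (H ω, Z ω)) ⁻¹' S) := by
    rw [Measure.restrict_restrict₀ ((hH.prodMk hZ).restrict.nullMeasurable hS), inter_comm,
      Measure.restrict_congr_set hdef]
  have key := restrict_apply_eq_lintegral_cond hH.restrict hZ.restrict hprod hS hE
  rw [← hres] at key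
  have hfp : firstPassage X D u =ᵐ[P] H := by
    filter_upwards [hgood] with ω hω
    simp only [firstPassage, H, pathHit, hω.1, firmValue, mul_exp_le_iff hD hu0, ha]
  have hac : P[|defaultAt X N D u 1] ≪ P := cond_absolutelyContinuous
  have hconc : ∀ᵐ v ∂((P[|defaultAt X N D u 1]).map H), v ∈ Iic (N : ℝ≥0∞) :=
    (ae_map_iff (hH.mono_ac hac) measurableSet_Iic).2 (ae_cond_of_ae_imp hm hle)
  have hdelay : ∀ᵐ ω ∂P[|defaultAt X N D u 1],
      delayAge X N D u 0 ω = pathAge (Z ω) 0 (N - (H ω).toNNReal) := by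
    refine ae_cond_of_ae_imp hm ?_
    filter_upwards [hgood, hle, hX.start] with ω hω hω' h0 hd
    have hHN := hω' hd
    have hHa := hω.2.2 (ne_top_of_le_ne_top ENNReal.coe_ne_top hHN)
    obtain ⟨h1, h2⟩ := hsplit ω hHN
    have hstart : delayAge X N D u 0 ω =
        sInf {t : ℝ≥0∞ | ∃ s : ℝ≥0, t = s ∧ s ≤ N ∧ a ≤ X (N - s) ω} := by
      simp [delayAge, pathAge, hω.2.1, h0, firmValue, ha]
    -- At time `H` the path is at the level, so the last time at or above it is not earlier than
    -- `H`, and only the fresh path matters.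
    rw [hstart, sInf_times_eq_of_mem (r' := N - (H ω).toNNReal) tsub_le_self
      (by rw [tsub_tsub_cancel_of_le h1, hHa])]
    simp only [pathAge, hZdef, passagePath, hω.2.1]
    rw [hHa]
    simp only [sub_nonneg]
    congr 1
    ext t
    refine exists_congr fun s => and_congr_right fun _ => and_congr_right fun hs => ?_
    rw [← add_tsub_assoc_of_le hs, h2]
  have hlhs : delayLaw X P N D u 1 B =
      P[|defaultAt X N D u 1] ((fun ω => (H ω, Z ω)) ⁻¹' E) := by
    refine (hX.delayLaw_apply hN hD hu 0 hB).trans (measure_congr ?_)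
    filter_upwards [hdelay] with ω hω
    refine propext ?_
    change delayAge X N D u 0 ω ∈ B ↔ pathAge (Z ω) 0 (N - (H ω).toNNReal) ∈ B
    rw [hω]
  rw [hlhs, Measure.map_congr (hac.ae_eq hfp), setLIntegral_congr_fun measurableSet_Iic
    (g := fun v => (pathLaw X P)[|Prod.mk v ⁻¹' S] (Prod.mk v ⁻¹' E))
    (fun v _ => hX.negativeAgeLaw_apply (N - v.toNNReal) hB),
    Measure.restrict_eq_self_of_ae_mem hconc, ProbabilityTheory.cond, Measure.map_smul, lintegral_smul_measure, ← key]
  rfl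

end DelayLaw

/-! ### Ladder times as record times, and the last minimum. -/

section LadderTimes

variable {R : ℝ → ℝ → Prop} {w : ℕ → ℝ}

/-- The ladder times of a sequence for a relation `R`: `T_0 = 0` and
`T_{n+1} = min {m > T_n : R w_{T_n} w_m}`. -/
def ladderTime (R : ℝ → ℝ → Prop) (w : ℕ → ℝ) : ℕ → ℕ∞
  | 0 => 0
  | n + 1 => sInf {r | ∃ m : ℕ, r = (m : ℕ∞) ∧ ladderTime R w n < m ∧
      R (w (ladderTime R w n).toNat) (w m)}

theorem ascendingLadderTime_eq (w : ℕ → ℝ) (n : ℕ) :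
    ascendingLadderTime w n = ladderTime (fun a b => a < b) w n := by
  induction n with
  | zero => rfl
  | succ n ih => simp only [ascendingLadderTime, ladderTime, ih]

theorem descendingLadderTime_eq (w : ℕ → ℝ) (n : ℕ) :
    descendingLadderTime w n = ladderTime (fun a b => b ≤ a) w n := by
  induction n with
  | zero => rfl
  | succ n ih => simp only [descendingLadderTime, ladderTime, ih]

theorem ladderTime_succ_eq_iff {n i : ℕ} : ladderTime R w (n + 1) = i ↔
    ∃ j < i, ladderTime R w n = j ∧ R (w j) (w i) ∧ ∀ m, j < m → m < i → ¬ R (w j) (w m) := by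
  have hdef : ladderTime R w (n + 1) = sInf {r | ∃ m : ℕ, r = (m : ℕ∞) ∧ ladderTime R w n < m ∧
      R (w (ladderTime R w n).toNat) (w m)} := rfl
  constructor
  · intro h
    have hne : {r | ∃ m : ℕ, r = (m : ℕ∞) ∧ ladderTime R w n < m ∧
        R (w (ladderTime R w n).toNat) (w m)}.Nonempty := by
      by_contra hcon
      rw [hdef, Set.not_nonempty_iff_eq_empty.1 hcon, sInf_empty] at h
      exact ENat.natCast_ne_top i h.symm
    have hmem := csInf_mem hne
    rw [← hdef, h] at hmem
    obtain ⟨m, hm, hlt, hR⟩ := hmem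
    obtain rfl : i = m := by exact_mod_cast hm
    have hfin : ladderTime R w n ≠ ⊤ := hlt.ne_top
    obtain ⟨j, hj⟩ := ENat.ne_top_iff_exists.1 hfin
    rw [← hj] at hlt hR
    refine ⟨j, by exact_mod_cast hlt, hj.symm, by simpa using hR, fun m hjm hmi hRm => ?_⟩
    have : ladderTime R w (n + 1) ≤ m := by
      rw [hdef, ← hj]
      exact sInf_le ⟨m, rfl, by exact_mod_cast hjm, by simpa using hRm⟩
    rw [h] at this
    exact absurd hmi (not_lt.2 (by exact_mod_cast this))
  · rintro ⟨j, hji, hj, hR, hmin⟩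
    rw [hdef, hj]
    refine le_antisymm (sInf_le ⟨i, rfl, by exact_mod_cast hji, by simpa using hR⟩) (le_sInf ?_)
    rintro _ ⟨m, rfl, hlt, hRm⟩
    have hjm : j < m := by exact_mod_cast hlt
    by_contra! hcon
    exact hmin m hjm (by exact_mod_cast hcon) (by simpa using hRm)

theorem ladderTime_lt_of_lt {n n' : ℕ} (h : n < n') {i : ℕ} (hi : ladderTime R w n' = i) :
    ladderTime R w n < i := by
  induction n' generalizing i with
  | zero => omega
  | succ n' ih =>
    obtain ⟨j, hji, hj, -⟩ := ladderTime_succ_eq_iff.1 hi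
    have hji' : (j : ℕ∞) < i := by exact_mod_cast hji
    rcases Nat.lt_succ_iff_lt_or_eq.1 h with h' | rfl
    · exact (ih h' hj).trans hji'
    · rw [hj]; exact hji'

theorem ladderTime_injOn {n n' i : ℕ} (h : ladderTime R w n = i) (h' : ladderTime R w n' = i) :
    n = n' := by
  rcases lt_trichotomy n n' with hlt | rfl | hlt
  · exact absurd (ladderTime_lt_of_lt hlt h') (by simp [h])
  · rfl
  · exact absurd (ladderTime_lt_of_lt hlt h) (by simp [h'])

/-- The ladder times are exactly the record times. -/
theorem exists_ladderTime_eq_iff (htrans : ∀ a b c, R a b → R b c → R a c)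
    (hneg : ∀ a b c, ¬ R a b → R a c → R b c) {i : ℕ} :
    (∃ n, ladderTime R w n = i) ↔ ∀ m < i, R (w m) (w i) := by
  constructor
  · rintro ⟨n, hn⟩
    induction n generalizing i with
    | zero =>
      intro m hm
      have : (0 : ℕ∞) = i := hn
      have : i = 0 := by exact_mod_cast this.symm
      omega
    | succ n ih =>
      obtain ⟨j, hji, hj, hR, hmin⟩ := ladderTime_succ_eq_iff.1 hn
      intro m hm
      rcases lt_trichotomy m j with h | rfl | h
      · exact htrans _ _ _ (ih hj m h) hR
      · exact hR
      -- Between consecutive ladder times `m` does not beat `j`, so whatever beats `j` also beats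
      -- `m`.
      · exact hneg _ _ _ (hmin m h hm) hR
  · intro h
    rcases Nat.eq_zero_or_pos i with rfl | hi
    · exact ⟨0, rfl⟩
    classical
    -- Let `j` be the greatest ladder time before `i`. An index in between that beats `j` would
    -- produce a later ladder time, so `i` is the successor of `j`.
    let p : ℕ → Prop := fun j => j < i ∧ ∃ n, ladderTime R w n = j
    have hp0 : p 0 := ⟨hi, 0, rfl⟩
    obtain ⟨hji, n, hn⟩ := Nat.findGreatest_spec (P := p) (Nat.zero_le i) hp0
    set j := Nat.findGreatest p i with hj
    have hmax : ∀ m, j < m → ¬ p m := by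
      intro m hjm hpm
      exact absurd (Nat.le_findGreatest hpm.1.le hpm) (not_le.2 hjm)
    by_cases hlater : ∃ m, j < m ∧ m < i ∧ R (w j) (w m)
    · exfalso
      obtain ⟨h1, h2, h3⟩ := Nat.find_spec hlater
      refine hmax _ h1 ⟨h2, n + 1, ladderTime_succ_eq_iff.2 ⟨j, h1, hn, h3, ?_⟩⟩
      intro m hjm hm hRm
      exact Nat.find_min hlater hm ⟨hjm, hm.trans h2, hRm⟩
    · refine ⟨n + 1, ladderTime_succ_eq_iff.2 ⟨j, hji, hn, h j hji, fun m hjm hmi hR => ?_⟩⟩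
      exact hlater ⟨m, hjm, hmi, hR⟩

/-- A finite stretch of a sequence has a unique last minimum. -/
theorem exists_last_argmin (w : ℕ → ℝ) (k : ℕ) :
    ∃ i ≤ k, (∀ m < i, w i ≤ w m) ∧ ∀ m, i < m → m ≤ k → w i < w m := by
  induction k with
  | zero => exact ⟨0, le_rfl, by omega, by omega⟩
  | succ k ih =>
    obtain ⟨i, hik, h1, h2⟩ := ih
    -- Ties move to the later index, which makes the record weak before it and the excursion strict
    -- after it.
    by_cases h : w (k + 1) ≤ w i
    · refine ⟨k + 1, le_rfl, fun m hm => ?_, by omega⟩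
      rcases lt_trichotomy m i with hmi | rfl | hmi
      · exact h.trans (h1 m hmi)
      · exact h
      · exact h.trans (h2 m hmi (by omega)).le
    · refine ⟨i, by omega, h1, fun m him hm => ?_⟩
      rcases Nat.lt_succ_iff_lt_or_eq.1 (Nat.lt_succ_of_le hm) with h' | rfl
      · exact h2 m him (by omega)
      · exact not_le.1 h

end LadderTimes

/-! ### Green functions of the ladder processes and duality. -/

section Green

variable {Ω : Type*} [MeasurableSpace Ω] {P : Measure Ω} {X : ℝ≥0 → Ω → ℝ} {N : ℝ≥0}

theorem measurableSet_ladderTime_eq {R : ℝ → ℝ → Prop} {w : Ω → ℕ → ℝ}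
    (hR : ∀ i j, MeasurableSet {ω | R (w ω i) (w ω j)}) (n i : ℕ) :
    MeasurableSet {ω | ladderTime R (w ω) n = i} := by
  induction n generalizing i with
  | zero =>
    simp only [ladderTime]
    exact MeasurableSet.const _
  | succ n ih =>
    have : {ω | ladderTime R (w ω) (n + 1) = i} = ⋃ j, ⋃ (_ : j < i),
        {ω | ladderTime R (w ω) n = j} ∩ ({ω | R (w ω j) (w ω i)} ∩
          ⋂ m, ⋂ (_ : j < m), ⋂ (_ : m < i), {ω | R (w ω j) (w ω m)}ᶜ) := by
      ext ω
      simp only [Set.mem_ofPred_eq, ladderTime_succ_eq_iff, mem_iUnion, mem_inter_iff, mem_iInter,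
        mem_compl_iff, exists_prop]
    rw [this]
    exact MeasurableSet.iUnion fun j => MeasurableSet.iUnion fun _ => (ih j).inter ((hR j i).inter
      (MeasurableSet.iInter fun m => MeasurableSet.iInter fun _ => MeasurableSet.iInter fun _ =>
        (hR j m).compl))

/-- Summing over the ladder index gives the law on the event of a record. -/
theorem sum_map_restrict_ladderTime {R : ℝ → ℝ → Prop} (htrans : ∀ a b c, R a b → R b c → R a c)
    (hneg : ∀ a b c, ¬ R a b → R a c → R b c) {w : Ω → ℕ → ℝ} (hw : ∀ i, Measurable fun ω => w ω i)
    (hR : ∀ i j, MeasurableSet {ω | R (w ω i) (w ω j)}) {φ : ℝ → ℝ} (hφ : Measurable φ) (i : ℕ) :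
    Measure.sum (fun n : ℕ => (P.restrict {ω | ladderTime R (w ω) n = (i : ℕ∞)}).map
        (fun ω => φ (w ω (ladderTime R (w ω) n).toNat))) =
      (P.restrict {ω | ∀ m < i, R (w ω m) (w ω i)}).map (fun ω => φ (w ω i)) := by
  have hm := measurableSet_ladderTime_eq hR
  have hU : {ω | ∀ m < i, R (w ω m) (w ω i)} = ⋃ n, {ω | ladderTime R (w ω) n = (i : ℕ∞)} := by
    ext ω
    simp only [Set.mem_ofPred_eq, mem_iUnion, exists_ladderTime_eq_iff htrans hneg]
  have hd : Pairwise (Function.onFun Disjoint fun n => {ω | ladderTime R (w ω) n = (i : ℕ∞)}) := by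
    intro n n' hne
    rw [Function.onFun, Set.disjoint_left]
    exact fun ω h h' => hne (ladderTime_injOn h h')
  have hφw : Measurable fun ω => φ (w ω i) := hφ.comp (hw i)
  ext B hB
  rw [Measure.sum_apply _ hB, Measure.map_apply hφw hB, hU,
    Measure.restrict_iUnion hd (fun n => hm n i), Measure.sum_apply _ (hφw hB)]
  refine tsum_congr fun n => ?_
  have : (fun ω => φ (w ω (ladderTime R (w ω) n).toNat))
      =ᵐ[P.restrict {ω | ladderTime R (w ω) n = (i : ℕ∞)}] fun ω => φ (w ω i) := by
    filter_upwards [ae_restrict_mem (hm n i)] with ω hω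
    have hω' : ladderTime R (w ω) n = (i : ℕ∞) := hω
    rw [hω', ENat.toNat_natCast]
  rw [Measure.map_congr this, Measure.map_apply hφw hB]

theorem IsLevyProcess.descendingGreen_eq (hX : IsLevyProcess X P) (i : ℕ) :
    descendingGreen X P N i =
      (P.restrict {ω | ∀ m : ℕ, m < i → X (i * N) ω ≤ X (m * N) ω}).map
        (fun ω => -X (i * N) ω) := by
  simp only [descendingGreen, descendingLadderTime_eq]
  exact sum_map_restrict_ladderTime (R := fun a b => b ≤ a)
    (w := fun ω (m : ℕ) => X (m * N) ω) (φ := fun y => -y)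
    (fun a b c h h' => h'.trans h) (fun a b c h h' => h'.trans (not_le.1 h).le)
    (fun i => hX.measurable _) (fun i j => measurableSet_le (hX.measurable _) (hX.measurable _))
    measurable_neg i

theorem IsLevyProcess.ascendingGreen_eq_record (hX : IsLevyProcess X P) (i : ℕ) :
    ascendingGreen X P N i =
      (P.restrict {ω | ∀ m : ℕ, m < i → X (m * N) ω < X (i * N) ω}).map (X (i * N)) := by
  simp only [ascendingGreen, ascendingLadderTime_eq]
  exact sum_map_restrict_ladderTime (R := fun a b => a < b)
    (w := fun ω (m : ℕ) => X (m * N) ω) (φ := fun y => y)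
    (fun a b c h h' => h.trans h') (fun a b c h h' => (not_lt.1 h).trans_lt h')
    (fun i => hX.measurable _) (fun i j => measurableSet_lt (hX.measurable _) (hX.measurable _))
    measurable_id i

/-- A power of a measure is invariant under reversal of the coordinates. -/
theorem map_rev_pi (μ : Measure ℝ) [IsProbabilityMeasure μ] (i : ℕ) :
    (Measure.pi fun _ : Fin i => μ).map (fun ξ j => ξ (Fin.rev j)) =
      Measure.pi fun _ : Fin i => μ := by
  have hm : Measurable fun (ξ : Fin i → ℝ) (j : Fin i) => ξ (Fin.rev j) :=
    measurable_pi_lambda _ fun j => measurable_pi_apply _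
  symm
  refine Measure.pi_eq fun s hs => ?_
  rw [Measure.map_apply hm (MeasurableSet.univ_pi hs)]
  have : (fun (ξ : Fin i → ℝ) (j : Fin i) => ξ (Fin.rev j)) ⁻¹' univ.pi s =
      univ.pi fun j => s (Fin.rev j) := by
    ext ξ
    simp only [mem_preimage, mem_univ_pi]
    exact ⟨fun h j => by simpa using h (Fin.rev j), fun h j => by simpa using h (Fin.rev j)⟩
  rw [this, Measure.pi_pi]
  exact Fintype.prod_equiv Fin.revPerm _ _ fun j => rfl

/-- Partial sums of a finite sequence. -/
def partialSum {i : ℕ} (ξ : Fin i → ℝ) (m : ℕ) : ℝ := ∑ j : Fin i, if (j : ℕ) < m then ξ j else 0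

theorem measurable_partialSum {i : ℕ} (m : ℕ) : Measurable fun ξ : Fin i → ℝ => partialSum ξ m := by
  refine Finset.measurable_sum _ fun j _ => ?_
  split_ifs
  · exact measurable_pi_apply j
  · exact measurable_const

/-- The first `m` reversed terms are the last `m` original ones. -/
theorem partialSum_rev {i : ℕ} (ξ : Fin i → ℝ) {m : ℕ} (hm : m ≤ i) :
    partialSum (fun j => ξ (Fin.rev j)) m = partialSum ξ i - partialSum ξ (i - m) := by
  have h1 : partialSum (fun j => ξ (Fin.rev j)) m =
      ∑ j : Fin i, if i - m ≤ (j : ℕ) then ξ j else 0 := by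
    refine Fintype.sum_equiv Fin.revPerm _ _ fun j => ?_
    have : (j : ℕ) < m ↔ i - m ≤ (Fin.rev j : ℕ) := by
      rw [Fin.val_rev]
      omega
    simp only [Fin.revPerm_apply, this]
  rw [h1, partialSum, partialSum, ← Finset.sum_sub_distrib]
  refine Finset.sum_congr rfl fun j _ => ?_
  rcases lt_or_ge (j : ℕ) (i - m) with h | h
  · simp [h, not_le.2 h]
  · simp [h, not_lt.2 h]

theorem partialSum_increments {i : ℕ} (w : ℕ → ℝ) {m : ℕ} (hm : m ≤ i) :
    partialSum (fun j : Fin i => w (j + 1) - w j) m = w m - w 0 := by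
  rw [partialSum, Fin.sum_univ_eq_sum_range (fun j => if j < m then w (j + 1) - w j else 0) i,
    ← Finset.sum_filter]
  have : (Finset.range i).filter (· < m) = Finset.range m := by
    ext j
    simp only [Finset.mem_filter, Finset.mem_range]
    omega
  rw [this, Finset.sum_range_sub]

variable [IsProbabilityMeasure P]

/-- Duality: the ascending Green function is the law of the walk before it enters `(-∞, 0]`. -/
theorem IsLevyProcess.ascendingGreen_eq (hX : IsLevyProcess X P) (i : ℕ) :
    ascendingGreen X P N i =
      (P.restrict {ω | ∀ m : ℕ, 1 ≤ m → m ≤ i → 0 < X (m * N) ω}).map (X (i * N)) := by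
  rw [hX.ascendingGreen_eq_record]
  let ξ : Ω → Fin i → ℝ := fun ω j => X ((j + 1 : ℕ) * N) ω - X ((j : ℕ) * N) ω
  have hξ : Measurable ξ := measurable_pi_lambda _ fun j => hX.measurable_sub _ _
  have hF : IsProbabilityMeasure (P.map (X N)) :=
    Measure.isProbabilityMeasure_map (hX.measurable N).aemeasurable
  -- The steps are independent with a common law, so their joint law is invariant under reversal.
  have hlaw : P.map ξ = Measure.pi fun _ : Fin i => P.map (X N) := by
    have h := hX.map_increments 0 (t := fun m : ℕ => (m : ℝ≥0) * N)
      (fun a b hab => by dsimp only; gcongr) i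
    simp only [zero_add] at h
    rw [show ξ = fun ω (j : Fin i) => X ((j + 1 : ℕ) * N) ω - X ((j : ℕ) * N) ω from rfl, h]
    congr 1
    ext1 j
    have : (((j : ℕ) + 1 : ℕ) : ℝ≥0) * N - ((j : ℕ) : ℝ≥0) * N = N := by
      rw [Nat.cast_add, Nat.cast_one, add_mul, one_mul, add_tsub_cancel_left]
    rw [this]
  have hrev : Measurable fun (ξ : Fin i → ℝ) (j : Fin i) => ξ (Fin.rev j) :=
    measurable_pi_lambda _ fun j => measurable_pi_apply _
  have hps : ∀ᵐ ω ∂P, ∀ m ≤ i, partialSum (ξ ω) m = X (m * N) ω := by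
    filter_upwards [hX.start] with ω hω m hm
    rw [partialSum_increments (fun m : ℕ => X (m * N) ω) hm]
    simp [hω]
  ext B hB
  let G : Set (Fin i → ℝ) := {ξ | ∀ m : ℕ, 1 ≤ m → m ≤ i → 0 < partialSum ξ m} ∩
    {ξ | partialSum ξ i ∈ B}
  have hG : MeasurableSet G := by
    refine MeasurableSet.inter ?_ (measurable_partialSum i hB)
    simp only [Set.ofPred_forall]
    exact MeasurableSet.iInter fun m => MeasurableSet.iInter fun _ => MeasurableSet.iInter fun _ =>
      measurableSet_lt measurable_const (measurable_partialSum m)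
  have h2 : P (X (i * N) ⁻¹' B ∩ {ω | ∀ m : ℕ, 1 ≤ m → m ≤ i → 0 < X (m * N) ω}) =
      P (ξ ⁻¹' G) := by
    refine measure_congr ?_
    filter_upwards [hps] with ω hω
    refine propext ?_
    change (X (i * N) ω ∈ B ∧ ∀ m : ℕ, 1 ≤ m → m ≤ i → 0 < X (m * N) ω) ↔
      (∀ m : ℕ, 1 ≤ m → m ≤ i → 0 < partialSum (ξ ω) m) ∧ partialSum (ξ ω) i ∈ B
    rw [hω i le_rfl, and_comm]
    refine and_congr_left fun _ => forall₃_congr fun m _ hm => ?_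
    rw [hω m hm]
  -- Reversal turns "all earlier values are below the final one" into "all partial sums are
  -- positive" and preserves the endpoint.
  have h1 : P (X (i * N) ⁻¹' B ∩ {ω | ∀ m : ℕ, m < i → X (m * N) ω < X (i * N) ω}) =
      P (ξ ⁻¹' ((fun (ξ : Fin i → ℝ) (j : Fin i) => ξ (Fin.rev j)) ⁻¹' G)) := by
    refine measure_congr ?_
    filter_upwards [hps] with ω hω
    refine propext ?_
    change (X (i * N) ω ∈ B ∧ ∀ m : ℕ, m < i → X (m * N) ω < X (i * N) ω) ↔
      (∀ m : ℕ, 1 ≤ m → m ≤ i → 0 < partialSum (fun j => ξ ω (Fin.rev j)) m) ∧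
        partialSum (fun j => ξ ω (Fin.rev j)) i ∈ B
    have hz : partialSum (ξ ω) 0 = 0 := by simp [partialSum]
    rw [partialSum_rev (ξ ω) le_rfl, Nat.sub_self, hz, sub_zero, hω i le_rfl, and_comm]
    refine and_congr_left fun _ => ⟨fun h m h1 h2 => ?_, fun h m hm => ?_⟩
    · rw [partialSum_rev (ξ ω) h2, hω i le_rfl, hω (i - m) (by omega), sub_pos]
      exact h _ (by omega)
    · have := h (i - m) (by omega) (by omega)
      rw [partialSum_rev (ξ ω) (by omega), hω i le_rfl, hω _ (by omega), sub_pos,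
        Nat.sub_sub_self hm.le] at this
      exact this
  rw [Measure.map_apply (hX.measurable _) hB, Measure.map_apply (hX.measurable _) hB,
    Measure.restrict_apply (hX.measurable _ hB), Measure.restrict_apply (hX.measurable _ hB), h1,
    h2,
    ← Measure.map_apply hξ (hrev hG), ← Measure.map_apply hξ hG, hlaw,
    ← Measure.map_apply hrev hG, map_rev_pi]

/-- The Markov property at a fixed time. -/
theorem IsLevyProcess.measure_past_future (hX : IsLevyProcess X P) (c : ℝ≥0)
    {G : Set ((Iic c → ℝ) × (ℝ≥0 → ℝ))} (hG : MeasurableSet G) :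
    P {ω | ((fun s : Iic c => X s ω), fun t => incrementAfter X c t ω) ∈ G} =
      ∫⁻ ω, P {ω' | ((fun s : Iic c => X s ω), fun t => X t ω') ∈ G} ∂P := by
  have hU : Measurable fun ω (s : Iic c) => X s ω := measurable_pi_lambda _ fun s => hX.measurable s
  have hV : Measurable fun ω t => incrementAfter X c t ω :=
    measurable_pi_lambda _ fun t => hX.measurable_incrementAfter c t
  have hX' : Measurable fun ω t => X t ω := measurable_pi_lambda _ fun t => hX.measurable t
  have h := (indepFun_iff_map_prod_eq_prod_map_map hU.aemeasurable hV.aemeasurable).1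
    (hX.indepFun_incrementAfter c)
  have h' := congrArg (fun μ => μ G) h
  rw [Measure.map_apply (hU.prodMk hV) hG, hX.map_incrementAfter, Measure.prod_apply hG,
    lintegral_map (measurable_measure_prodMk_left hG) hU] at h'
  refine h'.trans (lintegral_congr fun ω => ?_)
  rw [Measure.map_apply hX' (measurable_prodMk_left hG)]
  rfl

end Green

/-! ### The joint law of default time and value, split at the last minimum. -/

section JointLaw

variable {Ω : Type*} {X : ℝ≥0 → Ω → ℝ} {N : ℝ≥0} {D x : ℝ}

theorem defaultValue_eq {ω : Ω} {k : ℕ} (hω : ω ∈ defaultAt X N D x k) :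
    defaultValue X N D x ω = firmValue X x (k * N) ω := by
  have : recordedDefault X N D x ω = ((k * N : ℝ≥0) : ℝ≥0∞) := hω
  rw [defaultValue, this, ENNReal.toNNReal_coe]

variable [MeasurableSpace Ω] {P : Measure Ω}

/-- The probability that the walk started from `z` stays above `z` for `j` steps and then lies in
`B`. -/
def stayAboveProb (X : ℝ≥0 → Ω → ℝ) (P : Measure Ω) (N : ℝ≥0) (j : ℕ) (B : Set ℝ) (z : ℝ) : ℝ≥0∞ :=
  P {ω | (∀ m : ℕ, 1 ≤ m → m ≤ j → 0 < X (m * N) ω) ∧ z + X ((j + 1 : ℕ) * N) ω ∈ B}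

theorem IsLevyProcess.measurableSet_stayAbove (hX : IsLevyProcess X P) (j : ℕ) :
    MeasurableSet {ω | ∀ m : ℕ, 1 ≤ m → m ≤ j → 0 < X (m * N) ω} := by
  simp only [Set.ofPred_forall]
  exact MeasurableSet.iInter fun m => MeasurableSet.iInter fun _ => MeasurableSet.iInter fun _ =>
    measurableSet_lt measurable_const (hX.measurable _)

theorem IsLevyProcess.measurableSet_descendingRecord (hX : IsLevyProcess X P) (i : ℕ) :
    MeasurableSet {ω | ∀ m : ℕ, m < i → X (i * N) ω ≤ X (m * N) ω} := by
  simp only [Set.ofPred_forall]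
  exact MeasurableSet.iInter fun m => MeasurableSet.iInter fun _ =>
    measurableSet_le (hX.measurable _) (hX.measurable _)

theorem measurable_measure_add_mem (μ : Measure ℝ) [SFinite μ] {B : Set ℝ} (hB : MeasurableSet B) :
    Measurable fun u => μ {y | u + y ∈ B} :=
  measurable_measure_prodMk_left (s := (fun p : ℝ × ℝ => p.1 + p.2) ⁻¹' B)
    ((measurable_fst.add measurable_snd) hB)

theorem IsLevyProcess.jointLaw_eq (hX : IsLevyProcess X P) (hN : 0 < N) (k : ℕ) :
    jointLaw X P N D x (k + 1) =
      (P.restrict (defaultAt X N D x (k + 1))).map (firmValue X x ((k + 1 : ℕ) * N)) := by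
  refine Measure.map_congr ?_
  filter_upwards [ae_restrict_mem (hX.measurableSet_defaultAt hN k)] with ω hω
  exact defaultValue_eq hω

variable [IsProbabilityMeasure P]

theorem IsLevyProcess.measurable_stayAboveProb (hX : IsLevyProcess X P) (j : ℕ) {B : Set ℝ}
    (hB : MeasurableSet B) : Measurable (stayAboveProb X P N j B) := by
  have hS : MeasurableSet
      ((Prod.snd ⁻¹' {ω | ∀ m : ℕ, 1 ≤ m → m ≤ j → 0 < X (m * N) ω}) ∩
        (fun p : ℝ × Ω => p.1 + X ((j + 1 : ℕ) * N) p.2) ⁻¹' B) :=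
    (measurable_snd (hX.measurableSet_stayAbove j)).inter
      ((measurable_fst.add ((hX.measurable _).comp measurable_snd)) hB)
  exact measurable_measure_prodMk_left hS

/-- The inner integral of the joint law. -/
theorem IsLevyProcess.lintegral_ascendingGreen (hX : IsLevyProcess X P) (j : ℕ) {B : Set ℝ}
    (hB : MeasurableSet B) (z : ℝ) :
    ∫⁻ u in Ici z, (P.map (X N)) {y | u + y ∈ B}
        ∂((ascendingGreen X P N j).map (fun h => h + z)) = stayAboveProb X P N j B z := by
  have hF : IsProbabilityMeasure (P.map (X N)) :=
    Measure.isProbabilityMeasure_map (hX.measurable N).aemeasurable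
  have hf := measurable_measure_add_mem (P.map (X N)) hB
  set A : Set Ω := {ω | ∀ m : ℕ, 1 ≤ m → m ≤ j → 0 < X (m * N) ω} with hA
  have hAm : MeasurableSet A := hX.measurableSet_stayAbove j
  have hmap : (ascendingGreen X P N j).map (fun h => h + z) =
      (P.restrict A).map (fun ω => X (j * N) ω + z) := by
    rw [hX.ascendingGreen_eq, Measure.map_map (measurable_add_const z) (hX.measurable _)]
    rfl
  have hm : Measurable fun ω => X (j * N) ω + z := (hX.measurable _).add_const z
  -- The range `u ≥ z` is automatic; the endpoint `u = z` is attained for `j = 0`.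
  have hconc : ∀ᵐ u ∂((P.restrict A).map (fun ω => X (j * N) ω + z)), u ∈ Ici z := by
    refine (ae_map_iff hm.aemeasurable measurableSet_Ici).2 ((ae_restrict_iff' hAm).2 ?_)
    filter_upwards [hX.start] with ω h0 hω
    rw [le_add_iff_nonneg_left]
    rcases Nat.eq_zero_or_pos j with rfl | hj
    · simp [h0]
    · exact (hω j hj le_rfl).le
  rw [hmap, Measure.restrict_eq_self_of_ae_mem hconc, lintegral_map hf hm,
    ← lintegral_indicator hAm]
  set c : ℝ≥0 := j * N with hc
  have hjc : ∀ m : ℕ, m ≤ j → (m : ℝ≥0) * N ≤ c := fun m hm => by rw [hc]; gcongr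
  let G₁ : Set (Iic c → ℝ) := {f | ∀ (m : ℕ) (_ : 1 ≤ m) (h : m ≤ j), 0 < f ⟨m * N, hjc m h⟩}
  have hG₁ : MeasurableSet G₁ := by
    simp only [G₁, Set.ofPred_forall]
    exact MeasurableSet.iInter fun m => MeasurableSet.iInter fun _ => MeasurableSet.iInter
      fun h => measurableSet_lt measurable_const (measurable_pi_apply _)
  let G : Set ((Iic c → ℝ) × (ℝ≥0 → ℝ)) := Prod.fst ⁻¹' G₁ ∩
    (fun p => p.1 ⟨c, mem_Iic.2 le_rfl⟩ + z + p.2 N) ⁻¹' B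
  have hstep : Measurable fun p : (Iic c → ℝ) × (ℝ≥0 → ℝ) =>
      p.1 ⟨c, mem_Iic.2 le_rfl⟩ + z + p.2 N := by fun_prop
  have hG : MeasurableSet G := (measurable_fst hG₁).inter (hstep hB)
  have key := hX.measure_past_future c hG
  have hlhs : P {ω | ((fun s : Iic c => X s ω), fun t => incrementAfter X c t ω) ∈ G} =
      stayAboveProb X P N j B z := by
    refine congrArg P ?_
    ext ω
    change (_ ∧ X c ω + z + (X (c + N) ω - X c ω) ∈ B) ↔ (_ ∧ z + X ((j + 1 : ℕ) * N) ω ∈ B)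
    have h1 : X c ω + z + (X (c + N) ω - X c ω) = z + X ((j + 1 : ℕ) * N) ω := by
      have : ((j + 1 : ℕ) : ℝ≥0) * N = c + N := by rw [hc]; push_cast; ring
      rw [this]
      ring
    rw [h1]
    rfl
  rw [← hlhs, key]
  refine lintegral_congr fun ω => ?_
  by_cases hω : ω ∈ A
  · have hs : MeasurableSet {y | X c ω + z + y ∈ B} := (measurable_const_add (X c ω + z)) hB
    rw [indicator_of_mem hω, Measure.map_apply (hX.measurable N) hs]
    refine congrArg P ?_
    ext ω'
    exact (and_iff_right (a := ∀ m : ℕ, 1 ≤ m → m ≤ j → 0 < X (m * N) ω) hω).symm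
  · rw [indicator_of_notMem hω]
    refine (measure_mono_null ?_ measure_empty).symm
    rintro ω' ⟨h, -⟩
    exact hω h

/-- The outer integral of the joint law. -/
theorem IsLevyProcess.lintegral_descendingGreen (hX : IsLevyProcess X P) (i j : ℕ) {B : Set ℝ}
    (hB : MeasurableSet B) (L l : ℝ) :
    ∫⁻ z in Ioc L l, stayAboveProb X P N j B z
        ∂((descendingGreen X P N i).map (fun h => l - h)) =
      P {ω | (∀ m : ℕ, m < i → X (i * N) ω ≤ X (m * N) ω) ∧ L < l + X (i * N) ω ∧
        (∀ m : ℕ, i < m → m ≤ i + j → X (i * N) ω < X (m * N) ω) ∧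
        l + X ((i + j + 1 : ℕ) * N) ω ∈ B} := by
  have hQ := hX.measurable_stayAboveProb (N := N) j hB
  set A : Set Ω := {ω | ∀ m : ℕ, m < i → X (i * N) ω ≤ X (m * N) ω} with hA
  have hAm : MeasurableSet A := hX.measurableSet_descendingRecord i
  have hm : Measurable fun ω => l + X (i * N) ω := (hX.measurable _).const_add l
  have hmap : (descendingGreen X P N i).map (fun h => l - h) =
      (P.restrict A).map (fun ω => l + X (i * N) ω) := by
    have hneg : Measurable fun ω => -X (i * N) ω := (hX.measurable _).neg
    rw [hX.descendingGreen_eq, Measure.map_map (measurable_id'.const_sub l) hneg]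
    congr 1
    ext ω
    simp
  -- A descending record lies at or below the starting point, so only the lower bound on `z` is a
  -- constraint.
  have hconc : (Ioc L l : Set ℝ) =ᵐ[(P.restrict A).map (fun ω => l + X (i * N) ω)] Ioi L := by
    have : ∀ᵐ z ∂((P.restrict A).map (fun ω => l + X (i * N) ω)), z ∈ Iic l := by
      refine (ae_map_iff hm.aemeasurable measurableSet_Iic).2 ((ae_restrict_iff' hAm).2 ?_)
      filter_upwards [hX.start] with ω h0 hω
      rw [add_le_iff_nonpos_right]
      rcases Nat.eq_zero_or_pos i with rfl | hi
      · simp [h0]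
      · have := hω 0 hi
        simpa [h0] using this
    filter_upwards [this] with z hz
    exact propext ⟨fun h => h.1, fun h => ⟨h, hz⟩⟩
  rw [hmap, Measure.restrict_congr_set hconc, Measure.restrict_map hm measurableSet_Ioi,
    lintegral_map hQ hm, Measure.restrict_restrict (hm measurableSet_Ioi),
    ← lintegral_indicator ((hm measurableSet_Ioi).inter hAm)]
  set c : ℝ≥0 := i * N with hc
  have hic : ∀ m : ℕ, m < i → (m : ℝ≥0) * N ≤ c := fun m hm => by rw [hc]; gcongr
  let e : Iic c := ⟨c, mem_Iic.2 le_rfl⟩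
  let G₁ : Set (Iic c → ℝ) := {f | ∀ (m : ℕ) (h : m < i), f e ≤ f ⟨m * N, hic m h⟩}
  have hG₁ : MeasurableSet G₁ := by
    simp only [G₁, Set.ofPred_forall]
    exact MeasurableSet.iInter fun m => MeasurableSet.iInter
      fun h => measurableSet_le (measurable_pi_apply _) (measurable_pi_apply _)
  let G₂ : Set (ℝ≥0 → ℝ) := {g | ∀ m : ℕ, 1 ≤ m → m ≤ j → 0 < g (m * N)}
  have hG₂ : MeasurableSet G₂ := by
    simp only [G₂, Set.ofPred_forall]
    exact MeasurableSet.iInter fun m => MeasurableSet.iInter fun _ => MeasurableSet.iInter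
      fun h => measurableSet_lt measurable_const (measurable_pi_apply _)
  have he : Measurable fun f : Iic c → ℝ => l + f e := by fun_prop
  let G : Set ((Iic c → ℝ) × (ℝ≥0 → ℝ)) := (Prod.fst ⁻¹' (G₁ ∩ (fun f => l + f e) ⁻¹' Ioi L)) ∩
    (Prod.snd ⁻¹' G₂ ∩ (fun p => l + p.1 e + p.2 ((j + 1 : ℕ) * N)) ⁻¹' B)
  have hstep : Measurable fun p : (Iic c → ℝ) × (ℝ≥0 → ℝ) =>
      l + p.1 e + p.2 ((j + 1 : ℕ) * N) := by fun_prop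
  have hG : MeasurableSet G := (measurable_fst (hG₁.inter (he measurableSet_Ioi))).inter
    ((measurable_snd hG₂).inter (hstep hB))
  have key := hX.measure_past_future c hG
  have hlhs : P {ω | ((fun s : Iic c => X s ω), fun t => incrementAfter X c t ω) ∈ G} =
      P {ω | (∀ m : ℕ, m < i → X c ω ≤ X (m * N) ω) ∧ L < l + X c ω ∧
        (∀ m : ℕ, i < m → m ≤ i + j → X c ω < X (m * N) ω) ∧
        l + X ((i + j + 1 : ℕ) * N) ω ∈ B} := by
    refine congrArg P ?_
    ext ω
    change ((ω ∈ A ∧ L < l + X c ω) ∧ (∀ m : ℕ, 1 ≤ m → m ≤ j → 0 < X (c + m * N) ω - X c ω) ∧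
      l + X c ω + (X (c + (j + 1 : ℕ) * N) ω - X c ω) ∈ B) ↔ (ω ∈ A ∧ L < l + X c ω ∧
        (∀ m : ℕ, i < m → m ≤ i + j → X c ω < X (m * N) ω) ∧
        l + X ((i + j + 1 : ℕ) * N) ω ∈ B)
    have hadd : ∀ m : ℕ, c + (m : ℝ≥0) * N = ((i + m : ℕ) : ℝ≥0) * N := fun m => by
      rw [hc]; push_cast; ring
    have h1 : l + X c ω + (X (c + (j + 1 : ℕ) * N) ω - X c ω) =
        l + X ((i + j + 1 : ℕ) * N) ω := by
      rw [hadd, ← add_assoc]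
      ring
    have h2 : (∀ m : ℕ, 1 ≤ m → m ≤ j → 0 < X (c + m * N) ω - X c ω) ↔
        ∀ m : ℕ, i < m → m ≤ i + j → X c ω < X (m * N) ω := by
      constructor
      · intro h m hm1 hm2
        have := h (m - i) (by omega) (by omega)
        rwa [sub_pos, hadd, Nat.add_sub_cancel' hm1.le] at this
      · intro h m hm1 hm2
        rw [sub_pos, hadd]
        exact h (i + m) (by omega) (by omega)
    rw [h1, h2, and_assoc]
  rw [← hlhs, key]
  refine lintegral_congr fun ω => ?_
  by_cases hω : ω ∈ ((fun ω => l + X c ω) ⁻¹' Ioi L ∩ A)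
  · rw [indicator_of_mem hω]
    refine congrArg P ?_
    ext ω'
    exact (and_iff_right (a := ω ∈ A ∧ L < l + X c ω) ⟨hω.2, hω.1⟩).symm
  · rw [indicator_of_notMem hω]
    refine (measure_mono_null ?_ measure_empty).symm
    rintro ω' ⟨⟨h1, h2⟩, -⟩
    exact hω ⟨h2, h1⟩

/-- The joint law of recorded default time and value, through the Green functions of the ladder
processes. -/
theorem IsLevyProcess.jointLaw_map_log (hX : IsLevyProcess X P) (hN : 0 < N) (hD : 0 < D)
    (hx : D < x) (k : ℕ) {B : Set ℝ} (hB : MeasurableSet B) :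
    (jointLaw X P N D x (k + 1)).map Real.log B =
      ∑ i ∈ Finset.range (k + 1),
        ∫⁻ z in Ioc (Real.log D) (Real.log x),
          ∫⁻ u in Ici z, (P.map (X N)) {y | u + y ∈ B ∩ Iic (Real.log D)}
            ∂((ascendingGreen X P N (k - i)).map (fun h => h + z))
          ∂((descendingGreen X P N i).map (fun h => Real.log x - h)) := by
  have hx0 : 0 < x := hD.trans hx
  have hB' : MeasurableSet (B ∩ Iic (Real.log D)) := hB.inter measurableSet_Iic
  -- `V i` says that the last minimum over `0, …, k` is at `i` and above `log D`, and that the next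
  -- value is at most `log D` with the final position in `B`.
  let V : ℕ → Set Ω := fun i =>
    {ω | (∀ m : ℕ, m < i → X (i * N) ω ≤ X (m * N) ω) ∧ Real.log D < Real.log x + X (i * N) ω ∧
        (∀ m : ℕ, i < m → m ≤ k → X (i * N) ω < X (m * N) ω) ∧
        Real.log x + X ((k + 1 : ℕ) * N) ω ∈ B ∩ Iic (Real.log D)}
  have hterm : ∀ i ∈ Finset.range (k + 1),
      ∫⁻ z in Ioc (Real.log D) (Real.log x),
          ∫⁻ u in Ici z, (P.map (X N)) {y | u + y ∈ B ∩ Iic (Real.log D)}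
            ∂((ascendingGreen X P N (k - i)).map (fun h => h + z))
          ∂((descendingGreen X P N i).map (fun h => Real.log x - h)) = P (V i) := by
    intro i hi
    have hik : i + (k - i) = k := by have := Finset.mem_range.1 hi; omega
    simp only [hX.lintegral_ascendingGreen (k - i) hB']
    rw [hX.lintegral_descendingGreen i (k - i) hB', hik]
  have hVm : ∀ i, MeasurableSet (V i) := by
    intro i
    have h1 : MeasurableSet {ω | ∀ m : ℕ, i < m → m ≤ k → X (i * N) ω < X (m * N) ω} := by
      simp only [Set.ofPred_forall]
      exact MeasurableSet.iInter fun m => MeasurableSet.iInter fun _ => MeasurableSet.iInter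
        fun _ => measurableSet_lt (hX.measurable _) (hX.measurable _)
    have h2 : MeasurableSet {ω | Real.log D < Real.log x + X (i * N) ω} :=
      measurableSet_lt measurable_const ((hX.measurable _).const_add _)
    exact (hX.measurableSet_descendingRecord i).inter
      (h2.inter (h1.inter (((hX.measurable _).const_add _) hB')))
  have hVd : (Finset.range (k + 1) : Set ℕ).PairwiseDisjoint V := by
    intro i hi j hj hij
    rw [Function.onFun, Set.disjoint_left]
    intro ω h h'
    have hi' : i < k + 1 := by simpa using hi
    have hj' : j < k + 1 := by simpa using hj
    rcases lt_or_gt_of_ne hij with hlt | hlt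
    · exact absurd (h'.1 i hlt) (not_le.2 (h.2.2.1 j hlt (by omega)))
    · exact absurd (h.1 j hlt) (not_le.2 (h'.2.2.1 i hlt (by omega)))
  rw [Finset.sum_congr rfl hterm, ← measure_biUnion_finset hVd fun i _ => hVm i, hX.jointLaw_eq hN,
    Measure.map_map Real.measurable_log (hX.measurable_firmValue x _),
    Measure.map_apply (Real.measurable_log.comp (hX.measurable_firmValue x _)) hB,
    Measure.restrict_apply ((Real.measurable_log.comp (hX.measurable_firmValue x _)) hB)]
  refine measure_congr ?_
  filter_upwards [hX.start] with ω h0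
  have hlog : ∀ t, Real.log (firmValue X x t ω) = Real.log x + X t ω := fun t => by
    rw [firmValue, Real.log_mul hx0.ne' (Real.exp_pos _).ne', Real.log_exp]
  have hlt : ∀ t, D < firmValue X x t ω ↔ Real.log D < Real.log x + X t ω := fun t => by
    rw [← hlog, Real.log_lt_log_iff hD (firmValue_pos hx0 t)]
  have hle : ∀ t, firmValue X x t ω ≤ D ↔ Real.log x + X t ω ≤ Real.log D := fun t => by
    rw [← hlog, Real.log_le_log_iff (firmValue_pos hx0 t) hD]
  refine propext ?_
  change (Real.log (firmValue X x ((k + 1 : ℕ) * N) ω) ∈ B ∧ ω ∈ defaultAt X N D x (k + 1)) ↔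
    ω ∈ ⋃ i ∈ Finset.range (k + 1), V i
  rw [mem_defaultAt_succ_iff hN, hlog, hle]
  simp only [hlt, mem_iUnion, Finset.mem_range, exists_prop]
  constructor
  · rintro ⟨h1, h2, h3⟩
    obtain ⟨i, hik, h4, h5⟩ := exists_last_argmin (fun m : ℕ => X (m * N) ω) k
    refine ⟨i, by omega, h4, ?_, h5, h1, h2⟩
    rcases Nat.eq_zero_or_pos i with rfl | hi
    -- A minimum at index `0` is not covered by survival, which starts at the first inspection; here
    -- `D < x` is needed.
    · simpa [h0] using Real.log_lt_log hD hx
    · exact h3 i hi hik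
  · rintro ⟨i, hik, h4, h6, h5, h1, h2⟩
    refine ⟨h1, h2, fun m hm1 hmk => ?_⟩
    rcases lt_trichotomy m i with h | rfl | h
    · exact h6.trans_le (by gcongr; exact h4 m h)
    · exact h6
    · exact h6.trans (by gcongr; exact h5 m h hmk)

end JointLaw

/-! ### Measurability of the default times and the law of the economic default. -/

section Times

variable {Ω : Type*} {X : ℝ≥0 → Ω → ℝ} {N : ℝ≥0} {D x : ℝ}

theorem iUnion_defaultAt_eq :
    ⋃ k : ℕ, defaultAt X N D x (k + 1) = {ω | recordedDefault X N D x ω ≠ ∞} := by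
  ext ω
  simp only [mem_iUnion]
  constructor
  · rintro ⟨k, hk⟩
    have : recordedDefault X N D x ω = (((k + 1 : ℕ) * N : ℝ≥0) : ℝ≥0∞) := hk
    change recordedDefault X N D x ω ≠ ∞
    rw [this]
    exact ENNReal.coe_ne_top
  · intro h
    rcases recordedDefault_cases X N D x ω with ⟨htop, -⟩ | ⟨k, hk, -⟩
    · exact absurd htop h
    · exact ⟨k, hk⟩

theorem pairwise_disjoint_defaultAt (hN : 0 < N) :
    Pairwise (Function.onFun Disjoint fun k : ℕ => defaultAt X N D x (k + 1)) := by
  intro i j hij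
  rw [Function.onFun, Set.disjoint_left]
  intro ω hi hj
  have h : (((i + 1 : ℕ) * N : ℝ≥0) : ℝ≥0∞) = (((j + 1 : ℕ) * N : ℝ≥0) : ℝ≥0∞) :=
    (show recordedDefault X N D x ω = _ from hi).symm.trans hj
  have := mul_right_cancel₀ hN.ne' (ENNReal.coe_injective h)
  have : i + 1 = j + 1 := by exact_mod_cast this
  omega

theorem economicDefault_le_recordedDefault (ω : Ω) :
    economicDefault X N D x ω ≤ recordedDefault X N D x ω := by
  rw [economicDefault]
  split_ifs with h
  · rw [h]
  · refine sSup_le ?_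
    rintro _ ⟨s, rfl, -, hs, -⟩
    exact hs

theorem economicDefault_eq_top_iff {ω : Ω} :
    economicDefault X N D x ω = ∞ ↔ recordedDefault X N D x ω = ∞ := by
  constructor
  · intro h
    have := economicDefault_le_recordedDefault (X := X) (N := N) (D := D) (x := x) ω
    rwa [h, top_le_iff] at this
  · intro h
    rw [economicDefault, if_pos h]

/-- Truncated subtraction is an involution here because `τ_e ≤ τ_r < ∞`. -/
theorem economicDefault_eq_sub {ω : Ω} {k : ℕ} (hω : ω ∈ defaultAt X N D x k) :
    economicDefault X N D x ω = ((k * N : ℝ≥0) : ℝ≥0∞) -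
      (recordedDefault X N D x ω - economicDefault X N D x ω) := by
  have h : recordedDefault X N D x ω = ((k * N : ℝ≥0) : ℝ≥0∞) := hω
  rw [← h, ENNReal.sub_sub_cancel (by rw [h]; exact ENNReal.coe_ne_top)
    (economicDefault_le_recordedDefault ω)]

variable [MeasurableSpace Ω] {P : Measure Ω}

/-- The default events cover `{τ_r < ∞}` countably, and on the complement `f` is constantly `∞`. -/
theorem aemeasurable_of_defaultAt (hX : IsLevyProcess X P) (hN : 0 < N) {f : Ω → ℝ≥0∞}
    (hf : ∀ k : ℕ, AEMeasurable f (P.restrict (defaultAt X N D x (k + 1))))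
    (htop : ∀ ω, recordedDefault X N D x ω = ∞ → f ω = ∞) : AEMeasurable f P := by
  have hU : MeasurableSet (⋃ k : ℕ, defaultAt X N D x (k + 1)) :=
    MeasurableSet.iUnion fun k => hX.measurableSet_defaultAt hN k
  have h1 : AEMeasurable f (P.restrict (⋃ k : ℕ, defaultAt X N D x (k + 1))) :=
    aemeasurable_iUnion_iff.2 hf
  have h2 : AEMeasurable f (P.restrict (⋃ k : ℕ, defaultAt X N D x (k + 1))ᶜ) := by
    refine (aemeasurable_const (b := (∞ : ℝ≥0∞))).congr ?_
    filter_upwards [ae_restrict_mem hU.compl] with ω hω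
    rw [iUnion_defaultAt_eq] at hω
    exact (htop ω (not_not.1 hω)).symm
  have := aemeasurable_union_iff.2 ⟨h1, h2⟩
  rwa [union_compl_self, Measure.restrict_univ] at this

theorem IsLevyProcess.lintegral_jointLaw (hX : IsLevyProcess X P) (hN : 0 < N)
    (hx : 0 < x) (k : ℕ) :
    ∫⁻ _ in Ioi (0 : ℝ), 1 ∂(jointLaw X P N D x (k + 1)) = P (defaultAt X N D x (k + 1)) := by
  have hpre : firmValue X x ((k + 1 : ℕ) * N) ⁻¹' Ioi 0 = univ :=
    eq_univ_of_forall fun ω => firmValue_pos hx _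
  rw [setLIntegral_one, hX.jointLaw_eq hN, Measure.map_apply (hX.measurable_firmValue x _)
    measurableSet_Ioi, hpre, Measure.restrict_apply_univ]

theorem IsLevyProcess.aemeasurable_recordedDefault (hX : IsLevyProcess X P) (hN : 0 < N) :
    AEMeasurable (recordedDefault X N D x) P := by
  refine aemeasurable_of_defaultAt (D := D) (x := x) hX hN (fun k => ?_) fun ω h => h
  refine (aemeasurable_const (b := ((((k + 1 : ℕ) : ℝ≥0) * N : ℝ≥0) : ℝ≥0∞))).congr ?_
  filter_upwards [ae_restrict_mem (hX.measurableSet_defaultAt hN k)] with ω hω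
  exact (show recordedDefault X N D x ω = _ from hω).symm

variable [IsProbabilityMeasure P]

theorem IsLevyProcess.aemeasurable_economicDefault (hX : IsLevyProcess X P) (hN : 0 < N)
    (hD : 0 < D) (hx : D ≤ x) : AEMeasurable (economicDefault X N D x) P := by
  refine aemeasurable_of_defaultAt (D := D) (x := x) hX hN (fun k => ?_)
    fun ω h => economicDefault_eq_top_iff.2 h
  refine ((hX.aemeasurable_delayAge N D x k).restrict.const_sub
    ((((k + 1 : ℕ) : ℝ≥0) * N : ℝ≥0) : ℝ≥0∞)).congr ?_
  filter_upwards [ae_restrict_mem (hX.measurableSet_defaultAt hN k),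
    ae_restrict_of_ae (hX.ae_delay_eq hN hD hx k)] with ω hω h
  rw [← h hω, ← economicDefault_eq_sub hω]

/-- If `P s = 0`, both sides are zero, in line with reading a law conditioned on a null event as
`0`. -/
theorem smul_cond_map (f : Ω → ℝ≥0∞) (s : Set Ω) :
    P s • (P[|s]).map f = (P.restrict s).map f := by
  rw [ProbabilityTheory.cond, Measure.map_smul, smul_smul]
  rcases eq_or_ne (P s) 0 with h | h
  · rw [Measure.restrict_eq_zero.2 h]
    simp
  · rw [ENNReal.mul_inv_cancel h (measure_ne_top P s), one_smul]

/-- The law of the economic default time, by conditioning on the recorded default time. -/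
theorem IsLevyProcess.map_economicDefault (hX : IsLevyProcess X P) (hN : 0 < N)
    (hD : 0 < D) (hx : D ≤ x) :
    (P.map (economicDefault X N D x)).restrict (Iio ∞) =
      Measure.sum (fun k : ℕ => P (defaultAt X N D x (k + 1)) •
        (P[|defaultAt X N D x (k + 1)]).map (economicDefault X N D x)) := by
  have hE := hX.aemeasurable_economicDefault hN hD hx
  -- `τ_e` and `τ_r` are finite together, so restricting the law to finite times restricts `P` to
  -- the disjoint union of the default events.
  have hset : economicDefault X N D x ⁻¹' Iio ∞ = ⋃ k : ℕ, defaultAt X N D x (k + 1) := by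
    rw [iUnion_defaultAt_eq]
    ext ω
    change economicDefault X N D x ω < ∞ ↔ recordedDefault X N D x ω ≠ ∞
    rw [lt_top_iff_ne_top, Ne, economicDefault_eq_top_iff]
  simp only [smul_cond_map]
  rw [Measure.restrict_map_of_aemeasurable hE measurableSet_Iio, hset,
    Measure.restrict_iUnion (pairwise_disjoint_defaultAt hN)
      fun k => hX.measurableSet_defaultAt hN k, Measure.map_sum]
  rw [← Measure.restrict_iUnion (pairwise_disjoint_defaultAt hN)
      fun k => hX.measurableSet_defaultAt hN k]
  exact hE.restrict

theorem IsLevyProcess.map_delayLaw (hX : IsLevyProcess X P) (hN : 0 < N)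
    (hD : 0 < D) (hx : D ≤ x) (k : ℕ) :
    (delayLaw X P N D x (k + 1)).map (fun s => ((((k + 1 : ℕ) : ℝ≥0) * N : ℝ≥0) : ℝ≥0∞) - s) =
      (P[|defaultAt X N D x (k + 1)]).map (economicDefault X N D x) := by
  have hm := hX.measurableSet_defaultAt (D := D) (x := x) hN k
  have hd : AEMeasurable (fun ω => recordedDefault X N D x ω - economicDefault X N D x ω)
      P[|defaultAt X N D x (k + 1)] :=
    ((hX.aemeasurable_recordedDefault hN).sub
      (hX.aemeasurable_economicDefault hN hD hx)).mono_ac cond_absolutelyContinuous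
  rw [delayLaw, AEMeasurable.map_map_of_aemeasurable (measurable_id'.const_sub _).aemeasurable hd]
  refine Measure.map_congr (ae_cond_of_ae_imp hm (Eventually.of_forall fun ω hω => ?_))
  exact (economicDefault_eq_sub hω).symm

end Times

end

end EconomicDefault

/-! ### Assembly of the theorem. -/

open EconomicDefault in
theorem mainTheorem4 {Ω : Type*} [MeasurableSpace Ω] (P : Measure Ω) [IsProbabilityMeasure P]
    (X : ℝ≥0 → Ω → ℝ) (hX : IsLevyProcess X P)
    (N : ℝ≥0) (hN : 0 < N) (D x : ℝ) (hD : 0 < D) (hx : D ≤ x) :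
    -- the default times are random variables
    AEMeasurable (recordedDefault X N D x) P ∧
    AEMeasurable (economicDefault X N D x) P ∧
    -- the law of `τ_e` on `[0, ∞)`, by conditioning on `τ_r = kN`, `k ≥ 1`
    (P.map (economicDefault X N D x)).restrict (Iio ∞) =
      Measure.sum (fun k : ℕ => P (defaultAt X N D x (k + 1)) •
        (P[|defaultAt X N D x (k + 1)]).map (economicDefault X N D x)) ∧
    -- the same through the conditional laws of `τ_r - τ_e`
    (P.map (economicDefault X N D x)).restrict (Iio ∞) =
      Measure.sum (fun k : ℕ => P (defaultAt X N D x (k + 1)) •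
        (delayLaw X P N D x (k + 1)).map
          (fun s => ((((k + 1 : ℕ) : ℝ≥0) * N : ℝ≥0) : ℝ≥0∞) - s)) ∧
    -- the same with `P_x[τ_r = kN]` as the integral of the joint law of `τ_r` and `S_{τ_r}`
    (P.map (economicDefault X N D x)).restrict (Iio ∞) =
      Measure.sum (fun k : ℕ => (∫⁻ _ in Ioi (0 : ℝ), 1 ∂(jointLaw X P N D x (k + 1))) •
        (delayLaw X P N D x (k + 1)).map
          (fun s => ((((k + 1 : ℕ) : ℝ≥0) * N : ℝ≥0) : ℝ≥0∞) - s)) ∧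
    -- the law of `τ_r - τ_e` given `τ_r = kN` is a mixture of the laws given default at `N`
    (∀ (k : ℕ) (B : Set ℝ≥0∞), MeasurableSet B →
      delayLaw X P N D x (k + 1) B =
        ∫⁻ u in Ici D, delayLaw X P N D u 1 B
          ∂((P[|defaultAt X N D x (k + 1)]).map (firmValue X x (k * N)))) ∧
    -- the laws that are mixed, in the spectrally positive case
    (IsSpectrallyPositive X P → ∀ u : ℝ, D ≤ u → ∀ B : Set ℝ≥0∞, MeasurableSet B →
      delayLaw X P N D u 1 B =
        ∫⁻ v in Iic (N : ℝ≥0∞), negativeAgeLaw X P (N - v.toNNReal) B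
          ∂((P[|defaultAt X N D u 1]).map (firstPassage X D u))) ∧
    -- the joint law of `τ_r` and `log S_{τ_r}` through the Green functions of the ladder processes
    (D < x → ∀ (k : ℕ) (B : Set ℝ), MeasurableSet B →
      (jointLaw X P N D x (k + 1)).map Real.log B =
        ∑ i ∈ Finset.range (k + 1),
          ∫⁻ z in Ioc (Real.log D) (Real.log x),
            ∫⁻ u in Ici z, (P.map (X N)) {y | u + y ∈ B ∩ Iic (Real.log D)}
              ∂((ascendingGreen X P N (k - i)).map (fun h => h + z))
            ∂((descendingGreen X P N i).map (fun h => Real.log x - h))) := by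
  refine ⟨hX.aemeasurable_recordedDefault hN, hX.aemeasurable_economicDefault hN hD hx,
    hX.map_economicDefault hN hD hx, ?_, ?_,
    fun k B hB => hX.delayLaw_succ_eq_lintegral hN hD hx k hB,
    fun hpos u hu B hB => hX.delayLaw_one_eq_lintegral hpos hN hD hu hB,
    fun hlt k B hB => hX.jointLaw_map_log hN hD hlt k hB⟩
  · simp only [hX.map_delayLaw hN hD hx]
    exact hX.map_economicDefault hN hD hx
  · simp only [hX.map_delayLaw hN hD hx, hX.lintegral_jointLaw hN (hD.trans_le hx)]
    exact hX.map_economicDefault hN hD hx
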